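/- Let $K=L^2(0,\infty;dt)$ (complex-valued functions) and let $\mathcal F_+$ be the unitary cosine transform on $K$, $\mathcal F_+(f)(u)=2\int_0^\infty\cos(2\pi tu)f(t)\,dt$. For $a>0$ let the Sonine space $K_a\subset K$ be the closed subspace of those $f$ such that $f$ and $\mathcal F_+(f)$ both vanish almost everywhere on $(0,a)$. For $f\in K_a$ let $M(f)$ be the entire function which continues $\pi^{-s/2}\Gamma(\tfrac s2)\int_0^\infty f(t)t^{-s}\,dt$ from $\Re(s)>\tfrac12$. For $w\in\mathbb C$ and $k\ge 0$ let the evaluator $Z^a_{w,k}\in K_a$ be the unique vector such that $\int_0^\infty f(t)Z^a_{w,k}(t)\,dt=M(f)^{(k)}(w)$ for all $f\in K_a$. Let $\mathcal Z$ be a nonempty multiset of complex numbers, that is, a nonempty countable set of complex numbers $w$, each with a finite multiplicity $m(w)\ge1$. Its system of evaluators in $K_a$ is the family $(Z^a_{w,k})_{w\in\mathcal Z,\ 0\le k<m(w)}$. The system is called minimal if none of its members lies in the closed linear span of the others, and complete if its linear span is dense in $K_a$. Let $$a_1(\mathcal Z)=\sup\{a>0:\text{the system is minimal in }K_a\},\qquad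 a_2(\mathcal Z)=\inf\{a>0:\text{the system is complete in }K_a\}$$ in $[0,+\infty]$ (with $\sup\emptyset=0$, $\inf\emptyset=+\infty$). Then, for $0<a<\infty$, the system is minimal in $K_a$ if $a<a_1(\mathcal Z)$ and not minimal if $a>a_1(\mathcal Z)$; it is complete in $K_a$ if $a>a_2(\mathcal Z)$ and not complete if $a<a_2(\mathcal Z)$; and $$a_1(\mathcal Z)=a_2(\mathcal Z).$$ -/

import Mathlib

open MeasureTheory Set Topology
open scoped ENNReal FourierTransform

noncomputable section

namespace Sonine

/-! ### The Hilbert space `K = L²(0,∞; dt)` and the cosine transform -/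

/-- The Hilbert space `K = L²(0,∞; dt)` of complex-valued square-integrable functions. -/
abbrev HalfLineL2 : Type := Lp ℂ 2 (volume.restrict (Ioi (0 : ℝ)))

theorem quasiMeasurePreserving_abs :
    Measure.QuasiMeasurePreserving (fun t : ℝ => |t|) volume (volume.restrict (Ioi (0 : ℝ))) := by
  refine ⟨measurable_id.norm, Measure.AbsolutelyContinuous.mk fun s hs h0 => ?_⟩
  rw [Measure.restrict_apply hs] at h0
  rw [Measure.map_apply (by fun_prop) hs]
  have hsub : (fun t : ℝ => |t|) ⁻¹' s
      ⊆ (s ∩ Ioi 0) ∪ ((fun t : ℝ => -t) ⁻¹' (s ∩ Ioi 0) ∪ {0}) := by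
    intro t ht
    rcases lt_trichotomy t 0 with h | h | h
    · refine Or.inr (Or.inl ⟨?_, ?_⟩)
      · simpa [abs_of_neg h] using ht
      · simpa using h
    · exact Or.inr (Or.inr h)
    · refine Or.inl ⟨?_, h⟩
      simpa [abs_of_pos h] using ht
  refine measure_mono_null hsub (measure_union_null h0 (measure_union_null ?_ (by simp)))
  exact (Measure.measurePreserving_neg (volume : Measure ℝ)).quasiMeasurePreserving.preimage_null h0

theorem memLp_comp_abs (f : HalfLineL2) : MemLp (fun t : ℝ => f |t|) 2 volume := by
  have hf := Lp.memLp f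
  have hpos : MemLp (fun t : ℝ => f |t|) 2 (volume.restrict (Ioi (0 : ℝ))) := by
    refine (memLp_congr_ae ?_).2 hf
    filter_upwards [ae_restrict_mem measurableSet_Ioi] with t ht
    rw [abs_of_pos ht]
  have hmp : MeasurePreserving (fun t : ℝ => -t) (volume.restrict (Iio (0 : ℝ)))
      (volume.restrict (Ioi (0 : ℝ))) := by
    have h := (Measure.measurePreserving_neg (volume : Measure ℝ)).restrict_preimage
      (measurableSet_Ioi (a := (0 : ℝ)))
    simpa using h
  have hneg : MemLp (fun t : ℝ => f |t|) 2 (volume.restrict (Iio (0 : ℝ))) := by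
    have h := hpos.comp_measurePreserving hmp
    simpa [Function.comp_def] using h
  have hneg' : MemLp (fun t : ℝ => f |t|) 2 (volume.restrict (Ioi (0 : ℝ))ᶜ) := by
    rwa [compl_Ioi, ← Measure.restrict_congr_set Iio_ae_eq_Iic]
  classical
  have h := MemLp.piecewise measurableSet_Ioi hpos hneg'
  rwa [piecewise_same] at h

/-- The even extension `t ↦ f |t|` to the real line of an element `f` of `L²(0,∞)`. -/
def evenExtension : HalfLineL2 →ₗ[ℂ] Lp ℂ 2 (volume : Measure ℝ) where
  toFun f := (memLp_comp_abs f).toLp _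
  map_add' f g := by
    rw [← MemLp.toLp_add]
    refine MemLp.toLp_congr _ _ ?_
    exact quasiMeasurePreserving_abs.ae (Lp.coeFn_add f g)
  map_smul' c f := by
    rw [RingHom.id_apply, ← MemLp.toLp_const_smul]
    refine MemLp.toLp_congr _ _ ?_
    exact quasiMeasurePreserving_abs.ae (Lp.coeFn_smul c f)

/-- The (unitary) cosine transform on `L²(0,∞)`: the restriction to `(0,∞)` of the `L²` Fourier
transform (with kernel `exp (-2πi t u)`) of the even extension. On integrable `f` it is
`u ↦ 2 ∫₀^∞ cos (2π t u) f(t) dt`. -/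
def cosineTransform : HalfLineL2 →ₗ[ℂ] HalfLineL2 :=
  (LpToLpRestrictCLM ℝ ℂ ℂ (volume : Measure ℝ) 2 (Ioi (0 : ℝ))).toLinearMap ∘ₗ
    (Lp.fourierTransformₗᵢ ℝ ℂ).toLinearEquiv.toLinearMap ∘ₗ evenExtension

/-! ### The Sonine spaces -/

/-- The subspace of `L²(0,∞)` of functions vanishing almost everywhere on `(0,a)`. -/
def vanishingBelow (a : ℝ) : Submodule ℂ HalfLineL2 where
  carrier := {f | ∀ᵐ t ∂(volume.restrict (Ioi (0 : ℝ))), t < a → f t = 0}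
  zero_mem' := by
    filter_upwards [Lp.coeFn_zero ℂ 2 (volume.restrict (Ioi (0 : ℝ)))] with t ht _
    simpa using ht
  add_mem' := by
    intro f g hf hg
    filter_upwards [hf, hg, Lp.coeFn_add f g] with t h1 h2 h3 hta
    rw [h3, Pi.add_apply, h1 hta, h2 hta, add_zero]
  smul_mem' := by
    intro c f hf
    filter_upwards [hf, Lp.coeFn_smul c f] with t h1 h2 hta
    rw [h2, Pi.smul_apply, h1 hta, smul_zero]

/-- The Sonine space `K_a`: the functions in `L²(0,∞)` which vanish, together with their
cosine transform, on `(0,a)`. -/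
def sonineSpace (a : ℝ) : Submodule ℂ HalfLineL2 :=
  vanishingBelow a ⊓ (vanishingBelow a).comap cosineTransform

/-! ### Completed Mellin transforms and evaluators -/

/-- The right Mellin transform `∫₀^∞ f(t) t^{-s} dt`. -/
def rightMellin (f : HalfLineL2) (s : ℂ) : ℂ :=
  ∫ t in Ioi (0 : ℝ), f t * (t : ℂ) ^ (-s)

/-- `Φ` is an entire function continuing the completed right Mellin transform
`π^{-s/2} Γ(s/2) ∫₀^∞ f(t) t^{-s} dt` from the half-plane `Re s > 1/2`, where for `f ∈ K_a`
the integral converges absolutely. Such a `Φ` is unique, by the identity theorem. -/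
def IsCompletedMellin (f : HalfLineL2) (Φ : ℂ → ℂ) : Prop :=
  Differentiable ℂ Φ ∧ ∀ s : ℂ, 1 / 2 < s.re → Φ s = Complex.Gammaℝ s * rightMellin f s

open Classical in
/-- The completed right Mellin transform `M(f)` as an entire function (it exists for `f` in
any `K_a`, `a > 0`; the value is `0` by convention when there is no entire continuation). -/
def completedMellin (f : HalfLineL2) : ℂ → ℂ :=
  if h : ∃ Φ, IsCompletedMellin f Φ then h.choose else 0

/-- `z ∈ K_a` represents `f ↦ M(f)^{(k)}(w)` on `K_a` for the bilinear form
`[f,g] = ∫₀^∞ f(t) g(t) dt`. -/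
def IsEvaluator (a : ℝ) (w : ℂ) (k : ℕ) (z : sonineSpace a) : Prop :=
  ∀ f : sonineSpace a,
    ∫ t in Ioi (0 : ℝ), (f : HalfLineL2) t * (z : HalfLineL2) t
      = iteratedDeriv k (completedMellin (f : HalfLineL2)) w

open Classical in
/-- The evaluator `Z^a_{w,k}` in `K_a`, the unique vector representing `f ↦ M(f)^{(k)}(w)`
(it exists for every `a > 0`, these linear forms being continuous). -/
def evaluator (a : ℝ) (w : ℂ) (k : ℕ) : sonineSpace a :=
  if h : ∃ z, IsEvaluator a w k z then h.choose else 0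

/-! ### Minimality and completeness -/

/-- An indexed family is minimal if none of its members is in the closed linear span of the
others. -/
def IsMinimalSystem {ι H : Type*} [NormedAddCommGroup H] [NormedSpace ℂ H] (u : ι → H) : Prop :=
  ∀ i, u i ∉ (Submodule.span ℂ (u '' {j | j ≠ i})).topologicalClosure

/-- An indexed family is complete if its linear span is dense. -/
def IsCompleteSystem {ι H : Type*} [NormedAddCommGroup H] [NormedSpace ℂ H] (u : ι → H) : Prop :=
  Dense (Submodule.span ℂ (range u) : Set H)

/-- The evaluators in `K_a` attached to a multiset of complex numbers, given by its multiplicity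
function `m : ℂ → ℕ`: all the `Z^a_{w,k}` with `0 ≤ k < m w`. -/
def evaluatorSystem (m : ℂ → ℕ) (a : ℝ) (i : Σ w : ℂ, Fin (m w)) : sonineSpace a :=
  evaluator a i.1 (i.2 : ℕ)

/-- The threshold `a₁ ∈ [0,∞]` for minimality: the supremum of the `a > 0` for which the
evaluators are minimal in `K_a`. -/
def minimalityThreshold (m : ℂ → ℕ) : ℝ≥0∞ :=
  sSup {x | ∃ a : ℝ, 0 < a ∧ x = ENNReal.ofReal a ∧ IsMinimalSystem (evaluatorSystem m a)}

/-- The threshold `a₂ ∈ [0,∞]` for completeness: the infimum of the `a > 0` for which the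
evaluators are complete in `K_a`. -/
def completenessThreshold (m : ℂ → ℕ) : ℝ≥0∞ :=
  sInf {x | ∃ a : ℝ, 0 < a ∧ x = ENNReal.ofReal a ∧ IsCompleteSystem (evaluatorSystem m a)}

end Sonine

end

noncomputable section

namespace Sonine

open Filter

/-! ### The Fourier transform on `L²(ℝ)` -/

/-! By Hilbert space duality, completeness in K_a means that no nonzero f ∈ K_a has M(f) vanishing
at every prescribed point with its multiplicity, and minimality means that the evaluators have a
biorthogonal system in K_a (`isCompleteSystem_iff`, `isMinimalSystem_iff`). Since K_b ⊆ K_a for a ≤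
b, both properties are monotone in a, so the thresholds separate. Their equality rests on two
implications.

Not complete implies minimal, in the same K_a. Zeros can be divided out inside K_a
(`exists_completedMellin_eq_sub_mul`). A nonzero f with all the prescribed zeros therefore yields,
for each k < m(w), a function of exact order k at w that keeps the zeros elsewhere; triangular
elimination turns these into a biorthogonal system. Hence a₂ ≤ a₁.

Minimal in K_b implies not complete in K_a when a < b. Take f ∈ K_b missing only the last zero at w.
The dilation t ↦ f((b/a)t) lies in K_a and multiplies M(f) by (b/a)^{s-1}, so a combination with f
itself has transform ((b/a)^{s-1} - (b/a)^{w-1}) M(f)(s): the missing zero is restored without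
leaving K_a. Hence a₁ ≤ a₂.

The analysis goes through the Gaussian transform θ_f. It determines f, turns the cosine transform
into θ(u) ↦ u⁻¹ θ(u⁻¹), decays faster than any power at 0 and ∞ when f ∈ K_a, and satisfies M(f)(s)
= 2 ∫ u^{s-1} θ_f(u) du, which gives the entire continuation. Division by s - w is realized by a
Hardy operator, which the cosine transform carries, up to sign, to the Hardy operator at 1 - w
(`cosineTransform_hardyLp`). The delicate point is that the quotient is square integrable
(`memLp_hardy`): Schur's test suffices for Re w < 1/2, and otherwise the zero of M(f) at w has to be
used. -/

theorem integral_mul_eq_inner {μ : Measure ℝ} {g : ℝ → ℂ} (hg : MemLp g 2 μ) (h : Lp ℂ 2 μ) :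
    ∫ x, h x * g x ∂μ = inner ℂ (star (hg.toLp g)) h := by
  rw [L2.inner_def]
  refine integral_congr_ae ?_
  filter_upwards [hg.coeFn_toLp, Lp.coeFn_star (hg.toLp g)] with x h1 h2
  rw [h2, Pi.star_apply, h1]
  simp

/-- The multiplication formula for the `L²` Fourier transform. -/
theorem integral_fourier_mul_eq (h : Lp ℂ 2 (volume : Measure ℝ)) {g : ℝ → ℂ} (hg1 : Integrable g)
    (hg2 : MemLp g 2) (hg3 : MemLp (𝓕 g) 2) :
    ∫ x, (𝓕 h : Lp ℂ 2 (volume : Measure ℝ)) x * g x = ∫ x, h x * 𝓕 g x := by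
  refine DenseRange.induction_on (p := fun h : Lp ℂ 2 (volume : Measure ℝ) =>
      ∫ x, (𝓕 h : Lp ℂ 2 (volume : Measure ℝ)) x * g x = ∫ x, h x * 𝓕 g x)
    (SchwartzMap.denseRange_toLpCLM (E := ℝ) (F := ℂ) (p := 2) ENNReal.ofNat_ne_top) h ?_ ?_
  -- Both sides are inner products with fixed vectors, hence continuous in `h`, so Schwartz
  -- functions suffice.
  · simp_rw [integral_mul_eq_inner hg2, integral_mul_eq_inner hg3]
    refine isClosed_eq ?_ (by fun_prop)
    have : Continuous fun h : Lp ℂ 2 (volume : Measure ℝ) => 𝓕 h :=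
      ContinuousFourier.continuous_fourier
    fun_prop
  · intro φ
    simp only [SchwartzMap.toLpCLM_apply, SchwartzMap.toLp_fourier_eq]
    have e1 : ∫ x, ((𝓕 φ : SchwartzMap ℝ ℂ).toLp 2 volume) x * g x = ∫ x, 𝓕 (φ : ℝ → ℂ) x * g x := by
      refine integral_congr_ae ?_
      filter_upwards [(𝓕 φ : SchwartzMap ℝ ℂ).coeFn_toLp 2 volume] with x hx
      rw [hx, SchwartzMap.fourier_coe]
    have e2 : ∫ x, (φ.toLp 2 volume) x * 𝓕 g x = ∫ x, φ x * 𝓕 g x := by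
      refine integral_congr_ae ?_
      filter_upwards [φ.coeFn_toLp 2 volume] with x hx
      rw [hx]
    rw [e1, e2]
    simpa using! VectorFourier.integral_fourierIntegral_smul_eq_flip (L := innerₗ ℝ)
      Real.continuous_fourierChar continuous_inner φ.integrable hg1

theorem fourier_comp_neg (g : ℝ → ℂ) (x : ℝ) : 𝓕 (fun y => g (-y)) x = 𝓕 g (-x) := by
  rw [Real.fourier_eq, Real.fourier_eq, ← integral_neg_eq_self]
  simp

theorem ae_neg {p : ℝ → Prop} (h : ∀ᵐ x, p x) : ∀ᵐ x : ℝ, p (-x) :=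
  (Measure.measurePreserving_neg (volume : Measure ℝ)).quasiMeasurePreserving.ae h

/-- The `L²` Fourier transform of an even function is even. -/
theorem fourier_even {h : Lp ℂ 2 (volume : Measure ℝ)} (hh : ∀ᵐ x, h (-x) = h x) :
    ∀ᵐ x, (𝓕 h : Lp ℂ 2 (volume : Measure ℝ)) (-x) = (𝓕 h : Lp ℂ 2 (volume : Measure ℝ)) x := by
  have hloc : LocallyIntegrable (𝓕 h : Lp ℂ 2 (volume : Measure ℝ)) volume :=
    (Lp.memLp _).locallyIntegrable (by norm_num)
  have hm := (Lp.memLp (𝓕 h : Lp ℂ 2 (volume : Measure ℝ))).comp_measurePreserving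
    (Measure.measurePreserving_neg (volume : Measure ℝ))
  -- The reflection is moved onto a test function, then through the multiplication formula onto `h`,
  -- where evenness is known.
  refine ae_eq_of_integral_contDiff_smul_eq (hm.locallyIntegrable (by norm_num)) hloc ?_
  intro g hg1 hg2
  have hs : HasCompactSupport (fun x => (g x : ℂ)) := hg2.comp_left (g := Complex.ofReal) rfl
  have hs' : HasCompactSupport (fun x => (g (-x) : ℂ)) := hs.comp_homeomorph (Homeomorph.neg ℝ)
  have hd : ContDiff ℝ ((⊤ : ℕ∞) : WithTop ℕ∞) (fun x => (g x : ℂ)) :=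
    Complex.ofRealCLM.contDiff.comp hg1
  have hd' : ContDiff ℝ ((⊤ : ℕ∞) : WithTop ℕ∞) (fun x => (g (-x) : ℂ)) := hd.comp contDiff_neg
  have key : ∀ φ : SchwartzMap ℝ ℂ, ∫ x, (𝓕 h : Lp ℂ 2 (volume : Measure ℝ)) x * φ x
      = ∫ x, h x * 𝓕 (φ : ℝ → ℂ) x := fun φ => by
    refine integral_fourier_mul_eq h φ.integrable (φ.memLp 2) ?_
    rw [← SchwartzMap.fourier_coe]
    exact (𝓕 φ : SchwartzMap ℝ ℂ).memLp 2
  have k1 : ∫ x, (𝓕 h : Lp ℂ 2 (volume : Measure ℝ)) x * (g x : ℂ)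
      = ∫ x, h x * 𝓕 (fun x => (g x : ℂ)) x := key (hs.toSchwartzMap hd)
  have k2 : ∫ x, (𝓕 h : Lp ℂ 2 (volume : Measure ℝ)) x * (g (-x) : ℂ)
      = ∫ x, h x * 𝓕 (fun x => (g (-x) : ℂ)) x := key (hs'.toSchwartzMap hd')
  have e1 : ∫ x, g x • ((𝓕 h : Lp ℂ 2 (volume : Measure ℝ)) ∘ Neg.neg) x
      = ∫ x, (𝓕 h : Lp ℂ 2 (volume : Measure ℝ)) x * (g (-x) : ℂ) := by
    rw [← integral_neg_eq_self]
    simp [mul_comm]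
  have e2 : ∫ x, h x * 𝓕 (fun x => (g (-x) : ℂ)) x = ∫ x, h x * 𝓕 (fun x => (g x : ℂ)) x := by
    rw [← integral_neg_eq_self]
    refine integral_congr_ae ?_
    filter_upwards [hh] with x hx
    rw [hx, fourier_comp_neg (fun x => (g x : ℂ)), neg_neg]
  calc _ = _ := e1
    _ = _ := k2
    _ = _ := e2
    _ = _ := k1.symm
    _ = _ := integral_congr_ae (.of_forall fun x => by simp [mul_comm])

/-! ### Gaussian transforms -/

/-- The Gaussian `t ↦ exp (-π u² t²)`. -/
def gaussian (u t : ℝ) : ℝ := Real.exp (-(Real.pi * u ^ 2) * t ^ 2)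

theorem continuous_gaussian (u : ℝ) : Continuous (gaussian u) := by
  unfold gaussian; fun_prop

theorem gaussian_pos (u t : ℝ) : 0 < gaussian u t := Real.exp_pos _

theorem gaussian_neg (u t : ℝ) : gaussian u (-t) = gaussian u t := by simp [gaussian]

theorem gaussian_sq (u t : ℝ) : gaussian u t ^ 2 = gaussian (√2 * u) t := by
  rw [gaussian, gaussian, ← Real.exp_nat_mul, mul_pow, Real.sq_sqrt (by norm_num)]
  congr 1
  push_cast
  ring

theorem integrable_gaussian {u : ℝ} (hu : 0 < u) : Integrable (gaussian u) :=
  integrable_exp_neg_mul_sq (by positivity)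

theorem memLp_gaussian {u : ℝ} (hu : 0 < u) : MemLp (fun t => (gaussian u t : ℂ)) 2 := by
  have h : MemLp (gaussian u) 2 := by
    rw [memLp_two_iff_integrable_sq (continuous_gaussian u).aestronglyMeasurable]
    simp_rw [gaussian_sq]
    exact integrable_gaussian (by positivity)
  exact h.ofReal

theorem fourier_gaussian {u : ℝ} (hu : 0 < u) :
    𝓕 (fun t => (gaussian u t : ℂ)) = fun t => ((u⁻¹ * gaussian u⁻¹ t : ℝ) : ℂ) := by
  have hb : 0 < ((u : ℂ) ^ 2).re := by norm_cast; positivity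
  have h := fourier_gaussian_pi hb
  have e1 : (fun t : ℝ => (gaussian u t : ℂ))
      = fun x : ℝ => Complex.exp (-Real.pi * (u : ℂ) ^ 2 * x ^ 2) := by
    ext t; simp [gaussian]
  rw [e1, h]
  ext t
  have e2 : ((u : ℂ) ^ 2) ^ (1 / 2 : ℂ) = u := by
    rw [← Complex.ofReal_pow, show (1 / 2 : ℂ) = ((1 / 2 : ℝ) : ℂ) by norm_num,
      ← Complex.ofReal_cpow (by positivity), ← Real.sqrt_eq_rpow, Real.sqrt_sq hu.le]
  rw [e2]
  simp [gaussian, div_eq_mul_inv]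

/-- The Gaussian transform `θ_f(u) = ∫₀^∞ f(t) exp (-π u² t²) dt`. -/
def theta (f : HalfLineL2) (u : ℝ) : ℂ := ∫ t in Ioi (0 : ℝ), f t * (gaussian u t : ℂ)

theorem integral_even {g : ℝ → ℂ} (hg : Integrable g) (he : ∀ᵐ x, g (-x) = g x) :
    ∫ x, g x = 2 * ∫ x in Ioi (0 : ℝ), g x := by
  rw [← integral_add_compl measurableSet_Ioi hg, compl_Ioi, two_mul]
  congr 1
  rw [← neg_zero, ← integral_comp_neg_Ioi]
  simp only [neg_zero]
  exact integral_congr_ae (ae_restrict_of_ae he)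

theorem coeFn_evenExtension (f : HalfLineL2) : evenExtension f =ᵐ[volume] fun t => f |t| :=
  (memLp_comp_abs f).coeFn_toLp

theorem coeFn_cosineTransform (f : HalfLineL2) :
    cosineTransform f =ᵐ[volume.restrict (Ioi 0)]
      (𝓕 (evenExtension f) : Lp ℂ 2 (volume : Measure ℝ)) :=
  LpToLpRestrictCLM_coeFn ℝ (Ioi (0 : ℝ)) _

/-- The Fourier transform exchanges the Gaussians of parameters u and u⁻¹ up to the factor u⁻¹. The
multiplication formula moves it onto the Gaussian, and evenness reduces both sides to the half-line.
-/
theorem theta_cosineTransform (f : HalfLineL2) {u : ℝ} (hu : 0 < u) :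
    theta (cosineTransform f) u = (u⁻¹ : ℂ) * theta f u⁻¹ := by
  have hev : ∀ᵐ x, evenExtension f (-x) = evenExtension f x := by
    filter_upwards [coeFn_evenExtension f, ae_neg (coeFn_evenExtension f)] with x h1 h2
    rw [h1, h2, abs_neg]
  have hu' : 0 < u⁻¹ := by positivity
  have hF : MemLp (𝓕 (fun t => (gaussian u t : ℂ))) 2 := by
    rw [fourier_gaussian hu]
    simpa using (memLp_gaussian hu').const_mul (u⁻¹ : ℂ)
  have hi : Integrable (fun t => (gaussian u t : ℂ)) := (integrable_gaussian hu).ofReal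
  have key := integral_fourier_mul_eq (evenExtension f) hi (memLp_gaussian hu) hF
  have i1 : Integrable (fun x => (𝓕 (evenExtension f) : Lp ℂ 2 (volume : Measure ℝ)) x
      * (gaussian u x : ℂ)) := (Lp.memLp _).integrable_mul (memLp_gaussian hu)
  have i2 : Integrable (fun x => evenExtension f x * 𝓕 (fun t => (gaussian u t : ℂ)) x) :=
    (Lp.memLp _).integrable_mul hF
  rw [integral_even i1, integral_even i2] at key
  · have key' := mul_left_cancel₀ two_ne_zero key
    rw [theta, theta, ← integral_const_mul]
    refine Eq.trans (integral_congr_ae ?_) (key'.trans (integral_congr_ae ?_))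
    · filter_upwards [coeFn_cosineTransform f] with x hx
      rw [hx]
    · filter_upwards [ae_restrict_of_ae (coeFn_evenExtension f), ae_restrict_mem measurableSet_Ioi]
        with x hx hx0
      rw [hx, fourier_gaussian hu, abs_of_pos hx0]
      push_cast
      ring
  · filter_upwards [hev] with x hx
    rw [hx, fourier_gaussian hu]
    simp only [gaussian_neg]
  · filter_upwards [fourier_even hev] with x hx
    rw [hx, gaussian_neg]

theorem memLp_gaussian_Ioi {u : ℝ} (hu : 0 < u) :
    MemLp (fun t => (gaussian u t : ℂ)) 2 (volume.restrict (Ioi (0 : ℝ))) :=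
  (memLp_gaussian hu).restrict _

/-- The Gaussian transform as the inner product with a vector of `L²(0,∞)`. -/
theorem theta_eq_inner {u : ℝ} (hu : 0 < u) (f : HalfLineL2) :
    theta f u = inner ℂ (star ((memLp_gaussian_Ioi hu).toLp _)) f :=
  integral_mul_eq_inner (memLp_gaussian_Ioi hu) f

theorem theta_add (f g : HalfLineL2) {u : ℝ} (hu : 0 < u) :
    theta (f + g) u = theta f u + theta g u := by
  simp only [theta_eq_inner hu, inner_add_right]

theorem theta_smul (c : ℂ) (f : HalfLineL2) {u : ℝ} (hu : 0 < u) :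
    theta (c • f) u = c * theta f u := by
  simp only [theta_eq_inner hu, inner_smul_right]

theorem theta_neg (f : HalfLineL2) {u : ℝ} (hu : 0 < u) : theta (-f) u = -theta f u := by
  simp only [theta_eq_inner hu, inner_neg_right]

theorem theta_sub (f g : HalfLineL2) {u : ℝ} (hu : 0 < u) :
    theta (f - g) u = theta f u - theta g u := by
  simp only [theta_eq_inner hu, inner_sub_right]

theorem theta_star (f : HalfLineL2) (u : ℝ) : theta (star f) u = star (theta f u) := by
  rw [theta, theta, Complex.star_def, ← integral_conj]
  refine integral_congr_ae ?_
  filter_upwards [Lp.coeFn_star f] with t ht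
  rw [ht]
  simp

theorem continuous_theta_left {u : ℝ} (hu : 0 < u) : Continuous fun f => theta f u := by
  simp only [theta_eq_inner hu]
  fun_prop

/-- The values u = √(n+1) give all positive powers of exp(-πt²), so the claim holds for polynomials;
Weierstrass approximation on [0,1] does the rest. -/
theorem integral_mul_comp_gaussian_eq_zero {f : HalfLineL2} (hf : ∀ u > 0, theta f u = 0)
    {φ : ℝ → ℝ} (hφ : ContinuousOn φ (Icc 0 1)) :
    ∫ t in Ioi (0 : ℝ), f t * (gaussian 1 t : ℂ) * (φ (gaussian 1 t) : ℂ) = 0 := by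
  set h : ℝ → ℂ := fun t => f t * (gaussian 1 t : ℂ) with hh
  have hint : Integrable h (volume.restrict (Ioi (0 : ℝ))) :=
    (Lp.memLp f).integrable_mul (memLp_gaussian_Ioi one_pos)
  have hmem : ∀ t, gaussian 1 t ∈ Icc (0 : ℝ) 1 := fun t =>
    ⟨(gaussian_pos 1 t).le, by
      rw [gaussian, Real.exp_le_one_iff]
      have := Real.pi_pos
      nlinarith [sq_nonneg t]⟩
  have hbd : ∀ {ψ : ℝ → ℝ}, ContinuousOn ψ (Icc 0 1) →
      Integrable (fun t => h t * (ψ (gaussian 1 t) : ℂ)) (volume.restrict (Ioi (0 : ℝ))) := by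
    intro ψ hψ
    obtain ⟨C, hC⟩ := isCompact_Icc.exists_bound_of_continuousOn hψ
    refine hint.mul_bdd (c := C) ?_ (.of_forall fun t => ?_)
    · have : Continuous fun t => ψ (gaussian 1 t) :=
        hψ.comp_continuous (continuous_gaussian 1) hmem
      exact (Complex.continuous_ofReal.comp this).aestronglyMeasurable
    · simpa using hC _ (hmem t)
  -- One Gaussian factor is already inside `h`, whence the parameter √(n+1) for the n-th power.
  have hmon : ∀ n : ℕ, ∫ t in Ioi (0 : ℝ), h t * ((gaussian 1 t ^ n : ℝ) : ℂ) = 0 := by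
    intro n
    rw [← hf (√(n + 1)) (by positivity), theta]
    refine integral_congr_ae (.of_forall fun t => ?_)
    simp only [hh, mul_assoc, ← Complex.ofReal_mul]
    congr 3
    rw [gaussian, gaussian, ← Real.exp_nat_mul, ← Real.exp_add, Real.sq_sqrt (by positivity)]
    congr 1
    ring
  have hpoly : ∀ p : Polynomial ℝ,
      ∫ t in Ioi (0 : ℝ), h t * ((p.eval (gaussian 1 t) : ℝ) : ℂ) = 0 := by
    intro p
    induction p using Polynomial.induction_on' with
    | add p q hp hq =>
      have := integral_add (hbd p.continuous.continuousOn) (hbd q.continuous.continuousOn)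
      rw [hp, hq, add_zero] at this
      rw [← this]
      refine integral_congr_ae (.of_forall fun t => ?_)
      simp [mul_add]
    | monomial n c =>
      have := congrArg (fun z => (c : ℂ) * z) (hmon n)
      simp only [mul_zero] at this
      rw [← this, ← integral_const_mul]
      refine integral_congr_ae (.of_forall fun t => ?_)
      simp only [Polynomial.eval_monomial]
      push_cast
      ring
  rw [← norm_le_zero_iff]
  refine le_of_forall_pos_le_add fun ε hε => ?_
  set N := ∫ t in Ioi (0 : ℝ), ‖h t‖ with hN
  have hN0 : 0 ≤ N := integral_nonneg fun _ => norm_nonneg _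
  -- The denominator is N + 1 because N may vanish.
  obtain ⟨p, hp⟩ := exists_polynomial_near_of_continuousOn 0 1 φ hφ (ε / (N + 1)) (by positivity)
  have e : ∫ t in Ioi (0 : ℝ), h t * (φ (gaussian 1 t) : ℂ)
      = ∫ t in Ioi (0 : ℝ), h t * ((φ (gaussian 1 t) - p.eval (gaussian 1 t) : ℝ) : ℂ) := by
    rw [← sub_zero (∫ t in Ioi (0 : ℝ), h t * (φ (gaussian 1 t) : ℂ)), ← hpoly p,
      ← integral_sub (hbd hφ) (hbd p.continuous.continuousOn)]
    refine integral_congr_ae (.of_forall fun t => ?_)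
    simp only
    push_cast
    ring
  rw [e, zero_add]
  calc _ ≤ ∫ t in Ioi (0 : ℝ), ‖h t‖ * (ε / (N + 1)) := by
        refine norm_integral_le_of_norm_le (hint.norm.mul_const _) (.of_forall fun t => ?_)
        rw [norm_mul]
        gcongr
        rw [Complex.norm_real, Real.norm_eq_abs, abs_sub_comm]
        exact (hp _ (hmem t)).le
    _ = N * (ε / (N + 1)) := by rw [integral_mul_const]
    _ ≤ ε := by
      rw [mul_div_assoc', div_le_iff₀ (by positivity)]
      nlinarith

/-- A function in `L²(0,∞)` is determined by its Gaussian transform. -/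
theorem eq_zero_of_theta {f : HalfLineL2} (hf : ∀ u > 0, theta f u = 0) : f = 0 := by
  have hae : ∀ᵐ x : ℝ, x ∈ Ioi (0 : ℝ) → f x = 0 := by
    refine isOpen_Ioi.ae_eq_zero_of_integral_contDiff_smul_eq_zero ?_ ?_
    · rw [locallyIntegrableOn_iff isOpen_Ioi.isLocallyClosed]
      intro k hk hkc
      have h1 : LocallyIntegrable f (volume.restrict (Ioi (0 : ℝ))) :=
        (Lp.memLp f).locallyIntegrable (by norm_num)
      have h2 := h1.integrableOn_isCompact hkc
      rwa [IntegrableOn, Measure.restrict_restrict hkc.measurableSet,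
        inter_eq_left.2 hk] at h2
    · intro g hg hgc hgs
      have hg0 : ∀ x ≤ 0, g x = 0 := fun x hx => by
        by_contra hne
        exact absurd (hgs (subset_tsupport g hne)) (by simpa using hx)
      obtain ⟨R, hR⟩ : ∃ R, ∀ x, R ≤ x → g x = 0 := by
        obtain ⟨R, hR⟩ := hgc.isCompact.bddAbove
        refine ⟨R + 1, fun x hx => ?_⟩
        by_contra hne
        have := hR (subset_tsupport g hne)
        linarith
      -- The substitution y = exp(-πt²) inverted, so that y φ(y) = g(t) for t > 0.
      set φ : ℝ → ℝ := fun y => g (√(-Real.log y / Real.pi)) / y with hφ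
      have hcont : ContinuousOn φ (Icc 0 1) := by
        intro y hy
        rcases hy.1.eq_or_lt with h0 | h0
        · have hev : φ =ᶠ[𝓝[Icc 0 1] y] fun _ => 0 := by
            -- Below this bound t exceeds |R|, where g vanishes. At y = 0 itself, division by zero
            -- gives φ(0) = 0, so φ is continuous there.
            have : ∀ᶠ z : ℝ in 𝓝[Icc 0 1] y, z < Real.exp (-(Real.pi * (|R|) ^ 2)) :=
              mem_nhdsWithin_of_mem_nhds (Iio_mem_nhds (by rw [← h0]; positivity))
            filter_upwards [this, self_mem_nhdsWithin] with z hz hz'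
            simp only [hφ]
            rcases hz'.1.eq_or_lt with hz0 | hz0
            · simp [← hz0]
            · rw [hR, zero_div]
              have := (Real.log_lt_iff_lt_exp hz0).2 hz
              refine (le_abs_self R).trans (Real.le_sqrt_of_sq_le ?_)
              rw [le_div_iff₀ Real.pi_pos]
              linarith
          refine (continuousWithinAt_const.congr_of_eventuallyEq hev ?_)
          simp [hφ, ← h0]
        · have h1 : ContinuousAt φ y := by
            have : ContinuousAt (fun y => g (√(-Real.log y / Real.pi))) y :=
              hg.continuous.continuousAt.comp
                ((Real.continuous_sqrt.continuousAt).comp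
                  ((Real.continuousAt_log h0.ne').neg.div_const _))
            exact this.div continuousAt_id h0.ne'
          exact h1.continuousWithinAt
      rw [← setIntegral_eq_integral_of_forall_compl_eq_zero (s := Ioi (0 : ℝ)),
        ← integral_mul_comp_gaussian_eq_zero hf hcont]
      · refine integral_congr_ae ?_
        filter_upwards [ae_restrict_mem measurableSet_Ioi] with t ht
        have ht' : (0 : ℝ) < t := ht
        have h1 : √(-Real.log (gaussian 1 t) / Real.pi) = t := by
          rw [gaussian, Real.log_exp]
          have : -(-(Real.pi * 1 ^ 2) * t ^ 2) / Real.pi = t ^ 2 := by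
            field_simp
          rw [this, Real.sqrt_sq ht'.le]
        have h2 := (gaussian_pos 1 t).ne'
        simp only [hφ, h1, Complex.real_smul]
        push_cast
        have h3 : (gaussian 1 t : ℂ) ≠ 0 := by exact_mod_cast h2
        field_simp
      · intro x hx
        rw [hg0 x (by simpa using hx), zero_smul]
  rw [Lp.eq_zero_iff_ae_eq_zero]
  exact (ae_restrict_iff' measurableSet_Ioi).2 hae

theorem eq_of_theta {f g : HalfLineL2} (h : ∀ u > 0, theta f u = theta g u) : f = g :=
  sub_eq_zero.1 <| eq_zero_of_theta fun u hu => by rw [theta_sub f g hu, h u hu, sub_self]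

/-! ### The cosine transform -/

theorem cosineTransform_cosineTransform (f : HalfLineL2) :
    cosineTransform (cosineTransform f) = f :=
  eq_of_theta fun u hu => by
    rw [theta_cosineTransform _ hu, theta_cosineTransform _ (inv_pos.2 hu), inv_inv]
    push_cast
    have : (u : ℂ) ≠ 0 := by exact_mod_cast hu.ne'
    field_simp

theorem cosineTransform_star (f : HalfLineL2) :
    cosineTransform (star f) = star (cosineTransform f) :=
  eq_of_theta fun u hu => by
    rw [theta_cosineTransform _ hu, theta_star, theta_star, theta_cosineTransform _ hu]
    simp

/-- Closed graph theorem: Gaussian transforms are continuous functionals that separate points, and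
on them the cosine transform is explicit. -/
theorem continuous_cosineTransform : Continuous cosineTransform := by
  refine LinearMap.continuous_of_seq_closed_graph _ fun s x y hs hy => ?_
  refine eq_of_theta fun u hu => ?_
  have h1 := ((continuous_theta_left hu).tendsto y).comp hy
  have h2 := (((continuous_theta_left (inv_pos.2 hu)).tendsto x).comp hs).const_mul (u⁻¹ : ℂ)
  rw [theta_cosineTransform _ hu]
  refine tendsto_nhds_unique h1 (h2.congr fun n => ?_)
  simp [theta_cosineTransform _ hu]

/-- The cosine transform as a continuous linear map. -/
def cosineTransformL : HalfLineL2 →L[ℂ] HalfLineL2 := ⟨cosineTransform, continuous_cosineTransform⟩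

/-! ### Elements of the Sonine spaces -/

theorem mem_vanishingBelow {a : ℝ} {f : HalfLineL2} :
    f ∈ vanishingBelow a ↔ ∀ᵐ t ∂(volume.restrict (Ioi (0 : ℝ))), t < a → f t = 0 := Iff.rfl

theorem mem_sonineSpace {a : ℝ} {f : HalfLineL2} :
    f ∈ sonineSpace a ↔ f ∈ vanishingBelow a ∧ cosineTransform f ∈ vanishingBelow a := Iff.rfl

theorem cosineTransform_mem {a : ℝ} {f : HalfLineL2} (hf : f ∈ sonineSpace a) :
    cosineTransform f ∈ sonineSpace a :=
  ⟨hf.2, by simpa [cosineTransform_cosineTransform] using hf.1⟩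

theorem star_mem_vanishingBelow {a : ℝ} {f : HalfLineL2} (hf : f ∈ vanishingBelow a) :
    star f ∈ vanishingBelow a := by
  rw [mem_vanishingBelow] at hf ⊢
  filter_upwards [hf, Lp.coeFn_star f] with t h1 h2 h3
  simp [h2, h1 h3]

theorem star_mem_sonineSpace {a : ℝ} {f : HalfLineL2} (hf : f ∈ sonineSpace a) :
    star f ∈ sonineSpace a := by
  refine ⟨star_mem_vanishingBelow hf.1, ?_⟩
  simpa [cosineTransform_star] using star_mem_vanishingBelow hf.2

theorem vanishingBelow_anti {a b : ℝ} (hab : a ≤ b) : vanishingBelow b ≤ vanishingBelow a := by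
  intro f hf
  rw [mem_vanishingBelow] at hf ⊢
  filter_upwards [hf] with t ht h
  exact ht (h.trans_le hab)

theorem sonineSpace_anti {a b : ℝ} (hab : a ≤ b) : sonineSpace b ≤ sonineSpace a :=
  fun _ hf => ⟨vanishingBelow_anti hab hf.1, vanishingBelow_anti hab hf.2⟩

theorem isClosed_vanishingBelow (a : ℝ) : IsClosed (vanishingBelow a : Set HalfLineL2) := by
  have h : (vanishingBelow a : Set HalfLineL2)
      = (LpToLpRestrictCLM ℝ ℂ ℂ (volume.restrict (Ioi (0 : ℝ))) 2 (Iio a)) ⁻¹' {0} := by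
    ext f
    rw [SetLike.mem_coe, mem_vanishingBelow, mem_preimage, mem_singleton_iff,
      Lp.eq_zero_iff_ae_eq_zero]
    have h1 := LpToLpRestrictCLM_coeFn (μ := volume.restrict (Ioi (0 : ℝ))) ℂ (Iio a) f
    refine (ae_restrict_iff' (μ := volume.restrict (Ioi (0 : ℝ))) (s := Iio a)
      (p := fun t => f t = 0) measurableSet_Iio).symm.trans ?_
    constructor
    · intro h; filter_upwards [h, h1] with t h2 h3; rw [h3, h2]; rfl
    · intro h; filter_upwards [h, h1] with t h2 h3; rw [← h3, h2]; rfl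
  rw [h]
  exact isClosed_singleton.preimage (ContinuousLinearMap.continuous _)

theorem isClosed_sonineSpace (a : ℝ) : IsClosed (sonineSpace a : Set HalfLineL2) :=
  (isClosed_vanishingBelow a).inter
    ((isClosed_vanishingBelow a).preimage continuous_cosineTransform)

instance (a : ℝ) : CompleteSpace (sonineSpace a) :=
  (isClosed_sonineSpace a).completeSpace_coe

/-! ### Decay of the Gaussian transform -/

theorem norm_toLp_sq {μ : Measure ℝ} {g : ℝ → ℂ} (hg : MemLp g 2 μ) :
    ‖hg.toLp g‖ ^ 2 = ∫ t, ‖g t‖ ^ 2 ∂μ := by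
  have h := inner_self_eq_norm_sq_to_K (𝕜 := ℂ) (hg.toLp g)
  rw [L2.inner_def] at h
  have h2 : ∫ t, inner ℂ (hg.toLp g t) (hg.toLp g t) ∂μ = ((∫ t, ‖g t‖ ^ 2 ∂μ : ℝ) : ℂ) := by
    rw [← integral_complex_ofReal]
    refine integral_congr_ae ?_
    filter_upwards [hg.coeFn_toLp] with t ht
    rw [ht, inner_self_eq_norm_sq_to_K]
    simp
  rw [h2] at h
  have h3 : (((∫ t, ‖g t‖ ^ 2 ∂μ : ℝ)) : ℂ) = ((‖hg.toLp g‖ ^ 2 : ℝ) : ℂ) := by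
    rw [h, Complex.ofReal_pow]
    rfl
  exact (Complex.ofReal_injective h3).symm

theorem norm_integral_mul_le {μ : Measure ℝ} {g : ℝ → ℂ} (hg : MemLp g 2 μ) (h : Lp ℂ 2 μ) :
    ‖∫ x, h x * g x ∂μ‖ ≤ ‖hg.toLp g‖ * ‖h‖ := by
  rw [integral_mul_eq_inner hg h]
  refine (norm_inner_le_norm _ _).trans_eq ?_
  congr 1
  rw [Lp.norm_def, Lp.norm_def]
  congr 1
  refine eLpNorm_congr_norm_ae ?_
  filter_upwards [Lp.coeFn_star (hg.toLp g)] with x hx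
  rw [hx, Pi.star_apply, norm_star]

/-- Cauchy–Schwarz against the Gaussian cut off to t ≥ a. Half of the exponent of its square yields
the decay, the other half a convergent integral, equal to 1/(2u) ≤ 1. -/
theorem norm_theta_le {a u : ℝ} (ha : 0 < a) (hu : 1 ≤ u) {f : HalfLineL2}
    (hf : f ∈ vanishingBelow a) :
    ‖theta f u‖ ≤ ‖f‖ * Real.exp (-(Real.pi * a ^ 2 / 2) * u ^ 2) := by
  have hu0 : 0 < u := by linarith
  set g : ℝ → ℂ := (Ici a).indicator fun t => (gaussian u t : ℂ) with hg
  have hgm : MemLp g 2 (volume.restrict (Ioi (0 : ℝ))) :=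
    (memLp_gaussian_Ioi hu0).indicator measurableSet_Ici
  have e : theta f u = ∫ t in Ioi (0 : ℝ), f t * g t := by
    refine integral_congr_ae ?_
    filter_upwards [mem_vanishingBelow.1 hf] with t ht
    by_cases h : t < a
    · simp [ht h]
    · simp [hg, indicator_of_mem (show t ∈ Ici a from not_lt.1 h)]
  have hnorm : ‖hgm.toLp g‖ ≤ Real.exp (-(Real.pi * a ^ 2 / 2) * u ^ 2) := by
    have hpos := Real.exp_pos (-(Real.pi * a ^ 2 / 2) * u ^ 2)
    refine abs_le_of_sq_le_sq' ?_ hpos.le |>.2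
    rw [norm_toLp_sq]
    have h2 : ∀ t, ‖g t‖ ^ 2 ≤ Real.exp (-(Real.pi * a ^ 2 / 2) * u ^ 2) ^ 2 * gaussian u t := by
      intro t
      by_cases h : a ≤ t
      · rw [hg, indicator_of_mem (show t ∈ Ici a from h), Complex.norm_real, Real.norm_eq_abs,
          sq_abs, gaussian, ← Real.exp_nat_mul, ← Real.exp_nat_mul, ← Real.exp_add]
        rw [Real.exp_le_exp]
        push_cast
        have := mul_le_mul_of_nonneg_left (pow_le_pow_left₀ ha.le h 2)
          (show 0 ≤ Real.pi * u ^ 2 by positivity)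
        nlinarith
      · rw [hg, indicator_of_notMem (show t ∉ Ici a from h)]
        have := gaussian_pos u t
        rw [norm_zero, zero_pow two_ne_zero]
        positivity
    calc _ ≤ ∫ t in Ioi (0 : ℝ), Real.exp (-(Real.pi * a ^ 2 / 2) * u ^ 2) ^ 2 * gaussian u t := by
          refine integral_mono_of_nonneg (.of_forall fun _ => by positivity)
            (((integrable_gaussian hu0).integrableOn).const_mul _) (.of_forall h2)
      _ = Real.exp (-(Real.pi * a ^ 2 / 2) * u ^ 2) ^ 2 * (√(Real.pi / (Real.pi * u ^ 2)) / 2) := by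
          rw [integral_const_mul]
          congr 1
          exact integral_gaussian_Ioi _
      _ ≤ _ := by
          refine mul_le_of_le_one_right (by positivity) ?_
          have : Real.pi / (Real.pi * u ^ 2) = (u⁻¹) ^ 2 := by
            have := Real.pi_pos.ne'
            field_simp
          rw [this, Real.sqrt_sq (by positivity)]
          have := inv_le_one_of_one_le₀ hu
          linarith
  rw [e, mul_comm]
  exact (norm_integral_mul_le hgm f).trans (by gcongr)

theorem exists_exp_neg_sq_le_rpow {c : ℝ} (hc : 0 < c) (r : ℝ) :
    ∃ C, 0 < C ∧ ∀ x : ℝ, 1 ≤ x → Real.exp (-c * x ^ 2) ≤ C * x ^ r := by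
  obtain ⟨n, hn⟩ := exists_nat_ge (-r)
  refine ⟨n.factorial / c ^ n, by positivity, fun x hx => ?_⟩
  have hx0 : 0 < x := by linarith
  have h1 := Real.pow_div_factorial_le_exp (c * x ^ 2) (by positivity) n
  have h2 : x ^ (-r) ≤ (x ^ 2) ^ n := by
    rw [← pow_mul, ← Real.rpow_natCast]
    refine Real.rpow_le_rpow_of_exponent_le hx ?_
    push_cast
    have : (0 : ℝ) ≤ n := n.cast_nonneg
    linarith
  rw [neg_mul, Real.exp_neg]
  rw [Real.rpow_neg hx0.le] at h2
  have hxr : 0 < x ^ r := by positivity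
  rw [mul_pow] at h1
  rw [inv_le_iff_one_le_mul₀ (by positivity)]
  calc (1 : ℝ) = n.factorial / c ^ n * x ^ r * (c ^ n * (x ^ r)⁻¹ / n.factorial) := by field_simp
    _ ≤ n.factorial / c ^ n * x ^ r * (c ^ n * (x ^ 2) ^ n / n.factorial) := by gcongr
    _ ≤ _ := by gcongr

/-- On a Sonine space the Gaussian transform decays faster than any power at `0` and at `∞`,
uniformly on bounded sets. -/
theorem exists_norm_theta_le {a : ℝ} (ha : 0 < a) (r : ℝ) :
    ∃ C, 0 < C ∧ ∀ f ∈ sonineSpace a, ∀ u : ℝ, 0 < u → ‖theta f u‖ ≤ C * ‖f‖ * u ^ r := by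
  have hc : 0 < Real.pi * a ^ 2 / 2 := by positivity
  obtain ⟨C₁, hC₁, h₁⟩ := exists_exp_neg_sq_le_rpow hc r
  -- For u ≤ 1 the bound is applied to the cosine transform at u⁻¹; the extra -1 absorbs the factor
  -- u⁻¹ of `theta_cosineTransform`.
  obtain ⟨C₂, hC₂, h₂⟩ := exists_exp_neg_sq_le_rpow hc (-r - 1)
  set N := ‖cosineTransformL‖ with hN
  have hN0 : 0 ≤ N := norm_nonneg _
  refine ⟨C₁ + N * C₂, by positivity, fun f hf u hu => ?_⟩
  have hur : 0 < u ^ r := Real.rpow_pos_of_pos hu r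
  rcases le_total 1 u with h | h
  · calc _ ≤ ‖f‖ * (C₁ * u ^ r) := (norm_theta_le ha h hf.1).trans (by gcongr; exact h₁ u h)
      _ ≤ _ := by
        have : 0 ≤ N * C₂ * ‖f‖ * u ^ r := by positivity
        nlinarith
  · have hu' : 1 ≤ u⁻¹ := (one_le_inv₀ hu).2 h
    have e : theta f u = (u⁻¹ : ℂ) * theta (cosineTransform f) u⁻¹ := by
      conv_lhs => rw [← cosineTransform_cosineTransform f]
      rw [theta_cosineTransform _ hu]
    rw [e, norm_mul, norm_inv, Complex.norm_real, Real.norm_of_nonneg hu.le]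
    calc _ ≤ u⁻¹ * (‖cosineTransform f‖ * (C₂ * u⁻¹ ^ (-r - 1))) := by
          gcongr
          exact (norm_theta_le ha hu' hf.2).trans (by gcongr; exact h₂ _ hu')
      _ ≤ u⁻¹ * (N * ‖f‖ * (C₂ * u⁻¹ ^ (-r - 1))) := by
          gcongr
          exact cosineTransformL.le_opNorm f
      _ = N * C₂ * ‖f‖ * u ^ r := by
          rw [Real.inv_rpow hu.le, ← Real.rpow_neg hu.le, neg_sub, sub_neg_eq_add,
            add_comm, Real.rpow_add_one hu.ne']
          field_simp
      _ ≤ _ := by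
        have : 0 ≤ C₁ * ‖f‖ * u ^ r := by positivity
        nlinarith

theorem continuousOn_theta (f : HalfLineL2) : ContinuousOn (theta f) (Ioi 0) := by
  intro u₀ hu₀
  have hu₀' : (0 : ℝ) < u₀ := hu₀
  refine ContinuousAt.continuousWithinAt ?_
  have hnear : ∀ᶠ u in 𝓝 u₀, u₀ / 2 < u := lt_mem_nhds (by linarith)
  -- Gaussians decrease in the parameter, so u₀/2 dominates a whole neighbourhood of u₀.
  refine continuousAt_of_dominated (bound := fun t => ‖f t * (gaussian (u₀ / 2) t : ℂ)‖)
    (.of_forall fun u => ?_) ?_ ?_ (.of_forall fun t => ?_)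
  · exact (Lp.aestronglyMeasurable f).mul
      (Complex.continuous_ofReal.comp (continuous_gaussian u)).aestronglyMeasurable
  · filter_upwards [hnear] with u hu
    refine .of_forall fun t => ?_
    rw [norm_mul, norm_mul, Complex.norm_real, Complex.norm_real, Real.norm_of_nonneg
      (gaussian_pos _ _).le, Real.norm_of_nonneg (gaussian_pos _ _).le]
    gcongr
    unfold gaussian
    gcongr
  · exact ((Lp.memLp f).integrable_mul (memLp_gaussian_Ioi (by positivity))).norm
  · unfold gaussian
    fun_prop

/-! ### The completed Mellin transform -/

theorem gaussian_comm (u t : ℝ) : gaussian u t = gaussian t u := by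
  unfold gaussian; ring_nf

theorem integral_rpow_mul_gaussian {σ t : ℝ} (hσ : 0 < σ) (ht : 0 < t) :
    IntegrableOn (fun u : ℝ => u ^ (σ - 1) * gaussian u t) (Ioi 0) ∧
    ∫ u in Ioi (0 : ℝ), u ^ (σ - 1) * gaussian u t
      = Real.pi ^ (-σ / 2) * (1 / 2) * Real.Gamma (σ / 2) * t ^ (-σ) := by
  have hb : 0 < Real.pi * t ^ 2 := by positivity
  have h1 := integrableOn_rpow_mul_exp_neg_mul_rpow (p := 2) (s := σ - 1) (b := Real.pi * t ^ 2)
    (by linarith) (by norm_num) hb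
  have h2 := integral_rpow_mul_exp_neg_mul_rpow (p := 2) (q := σ - 1) (b := Real.pi * t ^ 2)
    (by norm_num) (by linarith) hb
  have e : ∀ u : ℝ, gaussian u t = Real.exp (-(Real.pi * t ^ 2) * u ^ (2 : ℝ)) := fun u => by
    rw [gaussian_comm, gaussian, Real.rpow_two]
  simp_rw [e]
  refine ⟨h1, h2.trans ?_⟩
  rw [show -(σ - 1 + 1) / 2 = -σ / 2 by ring, show (σ - 1 + 1) / 2 = σ / 2 by ring,
    Real.mul_rpow Real.pi_pos.le (by positivity), ← Real.rpow_natCast, ← Real.rpow_mul ht.le]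
  rw [show ((2 : ℕ) : ℝ) * (-σ / 2) = -σ by push_cast; ring]
  ring

/-- The substitution u ↦ u² reduces this to Euler's integral. The resulting 1/2 is why M(f) is twice
the Mellin transform of θ_f. -/
theorem mellin_gaussian {s : ℂ} (hs : 0 < s.re) {t : ℝ} (ht : 0 < t) :
    ∫ u in Ioi (0 : ℝ), (u : ℂ) ^ (s - 1) * (gaussian u t : ℂ)
      = Complex.Gammaℝ s / 2 * (t : ℂ) ^ (-s) := by
  have hb : 0 < Real.pi * t ^ 2 := by positivity
  have h1 := mellin_comp_rpow (fun x : ℝ => Complex.exp (-((Real.pi * t ^ 2 : ℝ) * x))) s 2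
  have h2 := Complex.integral_cpow_mul_exp_neg_mul_Ioi (a := s / 2) (r := Real.pi * t ^ 2)
    (by simpa using hs) hb
  have e : ∫ u in Ioi (0 : ℝ), (u : ℂ) ^ (s - 1) * (gaussian u t : ℂ)
      = mellin (fun u : ℝ => Complex.exp (-((Real.pi * t ^ 2 : ℝ) * (u ^ (2 : ℝ) : ℝ)))) s := by
    rw [mellin]
    refine integral_congr_ae (.of_forall fun u => ?_)
    simp only [smul_eq_mul]
    rw [gaussian_comm, gaussian, Real.rpow_two]
    push_cast
    ring_nf
  rw [e, h1, mellin]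
  simp only [smul_eq_mul, Complex.ofReal_ofNat]
  rw [h2, Complex.Gammaℝ_def]
  have e3 : (1 / ((Real.pi * t ^ 2 : ℝ) : ℂ)) ^ (s / 2) = (Real.pi : ℂ) ^ (-s / 2) * (t : ℂ) ^ (-s) := by
    rw [one_div, ← Complex.ofReal_inv, mul_inv, Complex.ofReal_mul,
      Complex.mul_cpow_ofReal_nonneg (by positivity) (by positivity),
      show (t ^ 2)⁻¹ = t⁻¹ * t⁻¹ by field_simp, Complex.ofReal_mul,
      Complex.mul_cpow_ofReal_nonneg (by positivity) (by positivity),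
      ← Complex.cpow_add _ _ (by exact_mod_cast (inv_pos.2 ht).ne'), add_halves,
      Complex.ofReal_inv, Complex.ofReal_inv, Complex.inv_cpow _ _ (by
        rw [Complex.arg_ofReal_of_nonneg Real.pi_pos.le]; exact Real.pi_pos.ne),
      Complex.inv_cpow _ _ (by
        rw [Complex.arg_ofReal_of_nonneg ht.le]; exact Real.pi_pos.ne), neg_div,
      Complex.cpow_neg, Complex.cpow_neg]
  rw [e3, show |(2 : ℝ)|⁻¹ = (1 / 2 : ℝ) by norm_num, Complex.real_smul]
  push_cast
  ring

theorem theta_isBigO {a : ℝ} (ha : 0 < a) {f : HalfLineL2} (hf : f ∈ sonineSpace a) (r : ℝ)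
    {l : Filter ℝ} (hl : ∀ᶠ u in l, 0 < u) : theta f =O[l] fun u => u ^ r := by
  obtain ⟨C, -, h⟩ := exists_norm_theta_le ha r
  refine Asymptotics.IsBigO.of_bound (C * ‖f‖) ?_
  filter_upwards [hl] with u hu
  rw [Real.norm_of_nonneg (Real.rpow_nonneg hu.le r)]
  exact h f hf u hu

theorem locallyIntegrableOn_theta (f : HalfLineL2) : LocallyIntegrableOn (theta f) (Ioi 0) :=
  (continuousOn_theta f).locallyIntegrableOn measurableSet_Ioi

theorem mellinConvergent_theta {a : ℝ} (ha : 0 < a) {f : HalfLineL2} (hf : f ∈ sonineSpace a)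
    (s : ℂ) : MellinConvergent (theta f) s :=
  mellinConvergent_of_isBigO_rpow (locallyIntegrableOn_theta f)
    (theta_isBigO ha hf _ (eventually_gt_atTop 0)) (lt_add_one _)
    (theta_isBigO ha hf _ self_mem_nhdsWithin) (sub_one_lt _)

theorem differentiable_mellin_theta {a : ℝ} (ha : 0 < a) {f : HalfLineL2}
    (hf : f ∈ sonineSpace a) : Differentiable ℂ (mellin (theta f)) := fun _ =>
  mellin_differentiableAt_of_isBigO_rpow (locallyIntegrableOn_theta f)
    (theta_isBigO ha hf _ (eventually_gt_atTop 0)) (lt_add_one _)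
    (theta_isBigO ha hf _ self_mem_nhdsWithin) (sub_one_lt _)

theorem integrable_rpow_mul {a σ : ℝ} (ha : 0 < a) (hσ : 1 / 2 < σ) {f : HalfLineL2}
    (hf : f ∈ vanishingBelow a) :
    Integrable (fun t => ‖f t‖ * t ^ (-σ)) (volume.restrict (Ioi (0 : ℝ))) := by
  -- Cutting at a/2 keeps every t ≥ a, including t = a, and makes the power square integrable since
  -- 2σ > 1.
  set g : ℝ → ℝ := (Ioi (a / 2)).indicator fun t => t ^ (-σ) with hg
  have hm : Measurable g := by
    refine Measurable.indicator ?_ measurableSet_Ioi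
    fun_prop
  have hgm : MemLp g 2 (volume.restrict (Ioi (0 : ℝ))) := by
    rw [memLp_two_iff_integrable_sq hm.aestronglyMeasurable]
    have e : (fun t => g t ^ 2) = (Ioi (a / 2)).indicator fun t : ℝ => (t ^ (-σ)) ^ 2 := by
      ext t
      by_cases h : t ∈ Ioi (a / 2) <;> simp [hg, h]
    rw [e, integrable_indicator_iff measurableSet_Ioi, IntegrableOn,
      Measure.restrict_restrict measurableSet_Ioi,
      inter_eq_left.2 (Ioi_subset_Ioi (by positivity))]
    refine (integrableOn_Ioi_rpow_of_lt (show -(2 * σ) < -1 by linarith)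
      (by positivity : 0 < a / 2)).congr_fun (fun t ht => ?_) measurableSet_Ioi
    have ht0 : 0 < t := lt_trans (by positivity) ht
    simp only
    rw [← Real.rpow_natCast, ← Real.rpow_mul ht0.le]
    congr 1
    push_cast
    ring
  refine ((Lp.memLp f).norm.integrable_mul hgm).congr ?_
  filter_upwards [mem_vanishingBelow.1 hf] with t ht
  by_cases h : t < a
  · simp [ht h]
  · have : t ∈ Ioi (a / 2) := by
      simp only [mem_Ioi]; linarith [not_lt.1 h]
    simp [hg, this]

theorem measurable_gaussian_uncurry : Measurable fun p : ℝ × ℝ => (gaussian p.1 p.2 : ℂ) := by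
  unfold gaussian
  fun_prop

/-- Fubini: integrating the Gaussian in u first produces the Gamma factor. Absolute convergence
comes from `integrable_rpow_mul`. -/
theorem two_mul_mellin_theta {a : ℝ} (ha : 0 < a) {f : HalfLineL2} (hf : f ∈ vanishingBelow a)
    {s : ℂ} (hs : 1 / 2 < s.re) :
    2 * mellin (theta f) s = Complex.Gammaℝ s * rightMellin f s := by
  set μ := volume.restrict (Ioi (0 : ℝ)) with hμ
  have hs0 : 0 < s.re := by linarith
  have hint : Integrable (fun p : ℝ × ℝ => (p.1 : ℂ) ^ (s - 1) * (f p.2 * (gaussian p.1 p.2 : ℂ)))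
      (μ.prod μ) := by
    have hmeas : AEStronglyMeasurable
        (fun p : ℝ × ℝ => (p.1 : ℂ) ^ (s - 1) * (f p.2 * (gaussian p.1 p.2 : ℂ))) (μ.prod μ) := by
      refine AEStronglyMeasurable.mul ?_ (AEStronglyMeasurable.mul ?_ ?_)
      · exact (by fun_prop : Measurable fun p : ℝ × ℝ => (p.1 : ℂ) ^ (s - 1)).aestronglyMeasurable
      · exact (Lp.aestronglyMeasurable f).comp_snd
      · exact measurable_gaussian_uncurry.aestronglyMeasurable
    rw [integrable_prod_iff' hmeas]
    have hn : ∀ t : ℝ, ∀ u ∈ Ioi (0 : ℝ), ‖(u : ℂ) ^ (s - 1) * (f t * (gaussian u t : ℂ))‖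
        = ‖f t‖ * (u ^ (s.re - 1) * gaussian u t) := fun t u hu => by
      rw [norm_mul, norm_mul, Complex.norm_real, Real.norm_of_nonneg (gaussian_pos _ _).le,
        Complex.norm_cpow_eq_rpow_re_of_pos hu]
      simp only [Complex.sub_re, Complex.one_re]
      ring
    constructor
    · filter_upwards [ae_restrict_mem measurableSet_Ioi] with t ht
      refine ⟨?_, ?_⟩
      · refine AEStronglyMeasurable.mul ?_ (AEStronglyMeasurable.mul aestronglyMeasurable_const ?_)
        · exact (by fun_prop : Measurable fun u : ℝ => (u : ℂ) ^ (s - 1)).aestronglyMeasurable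
        · exact (measurable_gaussian_uncurry.comp (measurable_id.prodMk measurable_const)).aestronglyMeasurable
      · have := ((integral_rpow_mul_gaussian hs0 ht).1.const_mul ‖f t‖).hasFiniteIntegral
        refine this.congr' ?_
        filter_upwards [ae_restrict_mem measurableSet_Ioi] with u hu
        rw [hn t u hu, Real.norm_of_nonneg]
        have := gaussian_pos u t
        have hu' : (0 : ℝ) < u := hu
        positivity
    · refine ((integrable_rpow_mul ha hs hf).const_mul
        (Real.pi ^ (-s.re / 2) * (1 / 2) * Real.Gamma (s.re / 2))).congr ?_
      filter_upwards [ae_restrict_mem measurableSet_Ioi] with t ht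
      rw [setIntegral_congr_fun measurableSet_Ioi (hn t), integral_const_mul,
        (integral_rpow_mul_gaussian hs0 ht).2]
      ring
  have h1 : mellin (theta f) s
      = ∫ u, ∫ t, (u : ℂ) ^ (s - 1) * (f t * (gaussian u t : ℂ)) ∂μ ∂μ := by
    rw [mellin]
    refine integral_congr_ae (.of_forall fun u => ?_)
    simp only [smul_eq_mul]
    rw [theta, integral_const_mul]
  rw [h1, integral_integral_swap hint, rightMellin, ← integral_const_mul, ← integral_const_mul]
  refine integral_congr_ae ?_
  filter_upwards [ae_restrict_mem measurableSet_Ioi] with t ht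
  have : ∀ u : ℝ, (u : ℂ) ^ (s - 1) * (f t * (gaussian u t : ℂ))
      = f t * ((u : ℂ) ^ (s - 1) * (gaussian u t : ℂ)) := fun u => by ring
  simp_rw [this]
  rw [integral_const_mul, mellin_gaussian hs0 ht]
  ring

theorem isCompletedMellin_mellin_theta {a : ℝ} (ha : 0 < a) {f : HalfLineL2}
    (hf : f ∈ sonineSpace a) : IsCompletedMellin f fun s => 2 * mellin (theta f) s :=
  ⟨(differentiable_mellin_theta ha hf).const_mul 2, fun _ hs => two_mul_mellin_theta ha hf.1 hs⟩

theorem IsCompletedMellin.unique {f : HalfLineL2} {Φ Ψ : ℂ → ℂ} (hΦ : IsCompletedMellin f Φ)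
    (hΨ : IsCompletedMellin f Ψ) : Φ = Ψ := by
  have h1 : AnalyticOnNhd ℂ Φ univ := fun z _ => hΦ.1.analyticAt z
  have h2 : AnalyticOnNhd ℂ Ψ univ := fun z _ => hΨ.1.analyticAt z
  refine h1.eq_of_eventuallyEq h2 (z₀ := 1) ?_
  have : ∀ᶠ z : ℂ in 𝓝 1, 1 / 2 < z.re :=
    Complex.continuous_re.continuousAt.eventually_const_lt (by norm_num)
  filter_upwards [this] with z hz
  rw [hΦ.2 z hz, hΨ.2 z hz]

theorem completedMellin_eq {a : ℝ} (ha : 0 < a) {f : HalfLineL2} (hf : f ∈ sonineSpace a) :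
    completedMellin f = fun s => 2 * mellin (theta f) s := by
  have hex : ∃ Φ, IsCompletedMellin f Φ := ⟨_, isCompletedMellin_mellin_theta ha hf⟩
  rw [completedMellin, dif_pos hex]
  exact hex.choose_spec.unique (isCompletedMellin_mellin_theta ha hf)

theorem differentiable_completedMellin {a : ℝ} (ha : 0 < a) {f : HalfLineL2}
    (hf : f ∈ sonineSpace a) : Differentiable ℂ (completedMellin f) := by
  rw [completedMellin_eq ha hf]
  exact (differentiable_mellin_theta ha hf).const_mul 2

theorem completedMellin_add {a : ℝ} (ha : 0 < a) {f g : HalfLineL2} (hf : f ∈ sonineSpace a)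
    (hg : g ∈ sonineSpace a) :
    completedMellin (f + g) = completedMellin f + completedMellin g := by
  rw [completedMellin_eq ha hf, completedMellin_eq ha hg, completedMellin_eq ha (add_mem hf hg)]
  ext s
  simp only [Pi.add_apply]
  rw [← mul_add]
  congr 1
  have := integral_add (mellinConvergent_theta ha hf s) (mellinConvergent_theta ha hg s)
  rw [mellin, mellin, mellin, ← this]
  refine setIntegral_congr_fun measurableSet_Ioi fun u hu => ?_
  simp only [theta_add f g hu, smul_add]

theorem completedMellin_smul {a : ℝ} (ha : 0 < a) (c : ℂ) {f : HalfLineL2}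
    (hf : f ∈ sonineSpace a) : completedMellin (c • f) = c • completedMellin f := by
  rw [completedMellin_eq ha hf, completedMellin_eq ha (Submodule.smul_mem _ c hf)]
  ext s
  simp only [Pi.smul_apply, smul_eq_mul]
  have e : mellin (theta (c • f)) s = c * mellin (theta f) s := by
    rw [← smul_eq_mul, ← mellin_const_smul]
    refine setIntegral_congr_fun measurableSet_Ioi fun u hu => ?_
    rw [theta_smul c f hu]
    rfl
  rw [e]
  ring

/-- Mellin inversion on the imaginary axis gives θ_f = 0, and θ is injective. -/
theorem eq_zero_of_completedMellin {a : ℝ} (ha : 0 < a) {f : HalfLineL2}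
    (hf : f ∈ sonineSpace a) (h : completedMellin f = 0) : f = 0 := by
  rw [completedMellin_eq ha hf] at h
  have h0 : mellin (theta f) = fun _ => 0 := by
    ext s
    simpa using congrFun h s
  refine eq_zero_of_theta fun u hu => ?_
  rw [← mellinInv_mellin_eq 0 (theta f) hu (mellinConvergent_theta ha hf _) ?_
    ((continuousOn_theta f).continuousAt (Ioi_mem_nhds hu)), h0]
  · simp [mellinInv]
  · rw [h0]
    simp [Complex.VerticalIntegrable]

theorem exists_norm_completedMellin_le {a : ℝ} (ha : 0 < a) (w : ℂ) :
    ∃ C, ∀ f ∈ sonineSpace a, ∀ s : ℂ, ‖s - w‖ ≤ 1 → ‖completedMellin f s‖ ≤ C * ‖f‖ := by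
  -- On the unit disc about w, |u^{s-1}| is at most u^{Re w - 2} for u ≤ 1 and u^{Re w} for u > 1.
  -- The two exponents leave a constant near 0 and u^{-2} near ∞.
  obtain ⟨C₁, hC₁, h₁⟩ := exists_norm_theta_le ha (2 - w.re)
  obtain ⟨C₂, hC₂, h₂⟩ := exists_norm_theta_le ha (-w.re - 2)
  set B : ℝ → ℝ := fun u => C₁ * (Ioc (0 : ℝ) 1).indicator 1 u
    + C₂ * (Ioi (1 : ℝ)).indicator (fun u => u ^ (-2 : ℝ)) u with hB
  have hBi : IntegrableOn B (Ioi 0) := by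
    refine Integrable.integrableOn (Integrable.add (Integrable.const_mul ?_ _)
      (Integrable.const_mul ?_ _))
    · exact (integrable_indicator_iff measurableSet_Ioc).2
        (integrableOn_const (C := (1 : ℝ)) measure_Ioc_lt_top.ne)
    · exact (integrable_indicator_iff measurableSet_Ioi).2
        (integrableOn_Ioi_rpow_of_lt (by norm_num) one_pos)
  refine ⟨2 * ∫ u in Ioi (0 : ℝ), B u, fun f hf s hs => ?_⟩
  rw [completedMellin_eq ha hf, norm_mul, mul_assoc]
  simp only [Complex.norm_ofNat]
  gcongr
  rw [mellin, ← integral_mul_const]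
  refine norm_integral_le_of_norm_le (hBi.mul_const _) ?_
  filter_upwards [ae_restrict_mem measurableSet_Ioi] with u hu
  have hu0 : (0 : ℝ) < u := hu
  have hre := (Complex.abs_re_le_norm (s - w)).trans hs
  rw [Complex.sub_re, abs_le] at hre
  rw [norm_smul, Complex.norm_cpow_eq_rpow_re_of_pos hu0, Complex.sub_re, Complex.one_re]
  rcases le_or_gt u 1 with h | h
  · have e : B u = C₁ := by
      have : u ∉ Ioi (1 : ℝ) := by simpa using h
      simp [hB, hu0, h]
    rw [e]
    calc _ ≤ u ^ (w.re - 2) * (C₁ * ‖f‖ * u ^ (2 - w.re)) :=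
          mul_le_mul (Real.rpow_le_rpow_of_exponent_ge hu0 h (by linarith)) (h₁ f hf u hu0)
            (norm_nonneg _) (by positivity)
      _ = C₁ * ‖f‖ * u ^ ((w.re - 2) + (2 - w.re)) := by rw [Real.rpow_add hu0]; ring
      _ = _ := by simp
  · have e : B u = C₂ * u ^ (-2 : ℝ) := by
      have h' : ¬ u ≤ 1 := not_le.2 h
      simp [hB, h, h']
    rw [e]
    calc _ ≤ u ^ w.re * (C₂ * ‖f‖ * u ^ (-w.re - 2)) :=
          mul_le_mul (Real.rpow_le_rpow_of_exponent_le h.le (by linarith)) (h₂ f hf u hu0)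
            (norm_nonneg _) (by positivity)
      _ = C₂ * ‖f‖ * u ^ (w.re + (-w.re - 2)) := by rw [Real.rpow_add hu0]; ring
      _ = _ := by
        rw [show w.re + (-w.re - 2) = -2 by ring]
        ring

/-! ### The evaluators -/

/-- The linear form `f ↦ M(f)^{(k)}(w)` on a Sonine space. -/
def evalForm {a : ℝ} (ha : 0 < a) (w : ℂ) (k : ℕ) : sonineSpace a →L[ℂ] ℂ :=
  LinearMap.mkContinuousOfExistsBound
    { toFun := fun f => iteratedDeriv k (completedMellin (f : HalfLineL2)) w
      map_add' := fun f g => by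
        have h : ∀ f : sonineSpace a, ContDiffAt ℂ k (completedMellin (f : HalfLineL2)) w :=
          fun f => (differentiable_completedMellin ha f.2).contDiff.contDiffAt
        rw [Submodule.coe_add, completedMellin_add ha f.2 g.2, iteratedDeriv_add (h f) (h g)]
      map_smul' := fun c f => by
        rw [Submodule.coe_smul, completedMellin_smul ha c f.2, RingHom.id_apply]
        have h : ContDiffAt ℂ k (completedMellin (f : HalfLineL2)) w :=
          (differentiable_completedMellin ha f.2).contDiff.contDiffAt
        rw [iteratedDeriv_const_smul h] }
    (by
      obtain ⟨C, hC⟩ := exists_norm_completedMellin_le ha w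
      refine ⟨k.factorial * C, fun f => ?_⟩
      -- Cauchy's estimate on the unit circle, where the bound is uniform in `f`.
      have h := Complex.norm_iteratedDeriv_le_of_forall_mem_sphere_norm_le k one_pos
        (differentiable_completedMellin ha f.2).diffContOnCl (c := w)
        fun z hz => hC f f.2 z (by rw [← dist_eq_norm]; exact (Metric.mem_sphere.1 hz).le)
      simpa [mul_assoc] using h)

theorem evalForm_apply {a : ℝ} (ha : 0 < a) (w : ℂ) (k : ℕ) (f : sonineSpace a) :
    evalForm ha w k f = iteratedDeriv k (completedMellin (f : HalfLineL2)) w := rfl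

/-- Complex conjugation on a Sonine space. -/
def conj {a : ℝ} (f : sonineSpace a) : sonineSpace a := ⟨star (f : HalfLineL2), star_mem_sonineSpace f.2⟩

theorem conj_conj {a : ℝ} (f : sonineSpace a) : conj (conj f) = f :=
  Subtype.ext (star_star (f : HalfLineL2))

theorem conj_zero {a : ℝ} : conj (0 : sonineSpace a) = 0 :=
  Subtype.ext <| eq_zero_of_theta fun u hu => by
    have h := theta_sub 0 0 hu
    rw [sub_self, sub_self] at h
    exact (theta_star 0 u).trans (by rw [h, star_zero])

theorem integral_mul_eq_inner_conj {a : ℝ} (f z : sonineSpace a) :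
    ∫ t in Ioi (0 : ℝ), (f : HalfLineL2) t * (z : HalfLineL2) t = inner ℂ (conj z) f := by
  rw [Submodule.coe_inner, L2.inner_def]
  refine integral_congr_ae ?_
  filter_upwards [Lp.coeFn_star (z : HalfLineL2)] with x hx
  simp only [conj]
  rw [hx]
  simp

theorem inner_conj_left {a : ℝ} (f z : sonineSpace a) :
    inner ℂ (conj z) f = inner ℂ (conj f) z := by
  rw [← integral_mul_eq_inner_conj, ← integral_mul_eq_inner_conj]
  simp_rw [mul_comm]

theorem isEvaluator_evaluator {a : ℝ} (ha : 0 < a) (w : ℂ) (k : ℕ) :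
    IsEvaluator a w k (evaluator a w k) := by
  have hex : ∃ z, IsEvaluator a w k z := by
    -- Riesz representation; the conjugation passes from the inner product to the bilinear form.
    refine ⟨conj ((InnerProductSpace.toDual ℂ _).symm (evalForm ha w k)), fun f => ?_⟩
    rw [integral_mul_eq_inner_conj, conj_conj, InnerProductSpace.toDual_symm_apply, evalForm_apply]
  rw [evaluator, dif_pos hex]
  exact hex.choose_spec

theorem inner_evaluator {a : ℝ} (ha : 0 < a) (w : ℂ) (k : ℕ) (f : sonineSpace a) :
    inner ℂ (conj f) (evaluator a w k) = iteratedDeriv k (completedMellin (f : HalfLineL2)) w := by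
  rw [← inner_conj_left, ← integral_mul_eq_inner_conj, isEvaluator_evaluator ha]

theorem mem_orthogonal_span {H : Type*} [NormedAddCommGroup H] [InnerProductSpace ℂ H]
    (s : Set H) (h : H) : h ∈ (Submodule.span ℂ s)ᗮ ↔ ∀ z ∈ s, inner ℂ h z = 0 := by
  rw [Submodule.mem_orthogonal']
  refine ⟨fun H z hz => H z (Submodule.subset_span hz), fun H z hz => ?_⟩
  induction hz using Submodule.span_induction with
  | mem x hx => exact H x hx
  | zero => simp
  | add x y _ _ hx hy => rw [inner_add_right, hx, hy, add_zero]
  | smul c x _ hx => rw [inner_smul_right, hx, mul_zero]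

/-- The evaluators are complete if and only if `0` is the only function with these zeros. -/
theorem isCompleteSystem_iff {a : ℝ} (ha : 0 < a) (m : ℂ → ℕ) :
    IsCompleteSystem (evaluatorSystem m a) ↔ ∀ f ∈ sonineSpace a,
      (∀ w, ∀ k < m w, iteratedDeriv k (completedMellin f) w = 0) → f = 0 := by
  rw [IsCompleteSystem, Submodule.dense_iff_topologicalClosure_eq_top,
    Submodule.topologicalClosure_eq_top_iff, Submodule.eq_bot_iff]
  constructor
  · intro H f hf h
    have := H (conj ⟨f, hf⟩) ?_
    · have := congrArg conj this
      rw [conj_conj, conj_zero] at this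
      exact congrArg Subtype.val this
    · rw [mem_orthogonal_span]
      rintro _ ⟨⟨w, k⟩, rfl⟩
      rw [evaluatorSystem, inner_evaluator ha]
      exact h w k k.2
  · intro H h hh
    rw [mem_orthogonal_span] at hh
    have := H (conj h : sonineSpace a) (conj h).2 fun w k hk => by
      rw [← inner_evaluator ha, conj_conj]
      exact hh _ ⟨⟨w, k, hk⟩, rfl⟩
    have h0 : conj h = 0 := Subtype.ext this
    rw [← conj_conj h, h0, conj_zero]

/-- The evaluators are minimal if and only if they have a biorthogonal system. -/
theorem isMinimalSystem_iff {a : ℝ} (ha : 0 < a) (m : ℂ → ℕ) :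
    IsMinimalSystem (evaluatorSystem m a) ↔ ∀ w, ∀ k < m w, ∃ f ∈ sonineSpace a,
      iteratedDeriv k (completedMellin f) w ≠ 0 ∧
      ∀ z, ∀ j < m z, (z, j) ≠ (w, k) → iteratedDeriv j (completedMellin f) z = 0 := by
  have key : ∀ (w : ℂ) (k : ℕ) (hk : k < m w), evaluatorSystem m a ⟨w, k, hk⟩ ∉ (Submodule.span ℂ
      (evaluatorSystem m a '' {j | j ≠ ⟨w, k, hk⟩})).topologicalClosure ↔ ∃ f ∈ sonineSpace a,
      iteratedDeriv k (completedMellin f) w ≠ 0 ∧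
      ∀ z, ∀ j < m z, (z, j) ≠ (w, k) → iteratedDeriv j (completedMellin f) z = 0 := by
    intro w k hk
    rw [← Submodule.orthogonal_orthogonal_eq_closure, Submodule.mem_orthogonal]
    push Not
    constructor
    · rintro ⟨h, h1, h2⟩
      rw [mem_orthogonal_span] at h1
      refine ⟨conj h, (conj h).2, ?_, fun z j hj hne => ?_⟩
      · rwa [← inner_evaluator ha, conj_conj]
      · rw [← inner_evaluator ha, conj_conj]
        refine h1 _ ⟨⟨z, j, hj⟩, fun heq => hne ?_, rfl⟩
        have := congrArg (fun i : Σ w : ℂ, Fin (m w) => (i.1, (i.2 : ℕ))) heq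
        exact this
    · rintro ⟨f, hf, h1, h2⟩
      refine ⟨conj ⟨f, hf⟩, ?_, ?_⟩
      · rw [mem_orthogonal_span]
        rintro _ ⟨⟨z, j⟩, hne, rfl⟩
        rw [evaluatorSystem, inner_evaluator ha]
        refine h2 z j j.2 fun heq => hne ?_
        obtain ⟨h3, h4⟩ := Prod.mk.inj heq
        subst h3
        congr
        exact Fin.ext h4
      · rwa [evaluatorSystem, inner_evaluator ha]
  constructor
  · intro H w k hk
    exact (key w k hk).1 (H ⟨w, k, hk⟩)
  · rintro H ⟨w, k, hk⟩
    exact (key w k hk).2 (H w k hk)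

/-! ### Dilations -/

theorem map_mul_left_restrict_Ioi {r : ℝ} (hr : 0 < r) :
    Measure.map (fun t => r * t) (volume.restrict (Ioi (0 : ℝ)))
      = ENNReal.ofReal r⁻¹ • volume.restrict (Ioi (0 : ℝ)) := by
  have h : (fun t : ℝ => r * t) ⁻¹' Ioi 0 = Ioi 0 := by
    ext t; simp [hr]
  have h2 := Measure.restrict_map (μ := (volume : Measure ℝ)) (measurable_const_mul r)
    (measurableSet_Ioi (a := (0 : ℝ)))
  rw [h, Real.map_volume_mul_left hr.ne', Measure.restrict_smul, abs_of_pos (inv_pos.2 hr)] at h2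
  exact h2.symm

theorem lintegral_comp_mul_left_Ioi {r : ℝ} (hr : 0 < r) (g : ℝ → ℝ≥0∞) :
    ∫⁻ t in Ioi (0 : ℝ), g (r * t) = ENNReal.ofReal r⁻¹ * ∫⁻ t in Ioi (0 : ℝ), g t := by
  have h := (Homeomorph.mulLeft₀ r hr.ne').measurableEmbedding.lintegral_map
    (μ := volume.restrict (Ioi (0 : ℝ))) g
  rw [Homeomorph.coe_mulLeft₀, map_mul_left_restrict_Ioi hr, lintegral_smul_measure] at h
  exact h.symm

theorem memLp_comp_mul_left {r : ℝ} (hr : 0 < r) (f : HalfLineL2) :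
    MemLp (fun t => f (r * t)) 2 (volume.restrict (Ioi (0 : ℝ))) := by
  have h : MemLp f 2 (Measure.map (fun t => r * t) (volume.restrict (Ioi (0 : ℝ)))) := by
    rw [map_mul_left_restrict_Ioi hr]
    exact (Lp.memLp f).smul_measure ENNReal.ofReal_ne_top
  exact h.comp_of_map (measurable_const_mul r).aemeasurable

/-- The dilation `t ↦ f (r t)`. -/
def dilation {r : ℝ} (hr : 0 < r) (f : HalfLineL2) : HalfLineL2 := (memLp_comp_mul_left hr f).toLp _

theorem theta_dilation {r : ℝ} (hr : 0 < r) (f : HalfLineL2) (u : ℝ) :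
    theta (dilation hr f) u = (r⁻¹ : ℂ) * theta f (r⁻¹ * u) := by
  have h := integral_comp_mul_left_Ioi (fun t => f t * (gaussian (r⁻¹ * u) t : ℂ)) 0 hr
  rw [mul_zero, Complex.real_smul] at h
  rw [theta, theta, ← Complex.ofReal_inv, ← h]
  refine integral_congr_ae ?_
  filter_upwards [(memLp_comp_mul_left hr f).coeFn_toLp] with t ht
  rw [dilation, ht, gaussian, gaussian]
  congr 3
  field_simp

/-- Checked on Gaussian transforms, where both operations are changes of the variable u. -/
theorem cosineTransform_dilation {r : ℝ} (hr : 0 < r) (f : HalfLineL2) :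
    cosineTransform (dilation hr f)
      = (r⁻¹ : ℂ) • dilation (inv_pos.2 hr) (cosineTransform f) := by
  refine eq_of_theta fun u hu => ?_
  rw [theta_cosineTransform _ hu, theta_smul _ _ hu, theta_dilation, theta_dilation, inv_inv,
    theta_cosineTransform _ (by positivity), mul_inv]
  have h1 : (r : ℂ) ≠ 0 := by exact_mod_cast hr.ne'
  have h2 : (u : ℂ) ≠ 0 := by exact_mod_cast hu.ne'
  push_cast
  field_simp

theorem dilation_mem_vanishingBelow {a r : ℝ} (hr : 0 < r) {f : HalfLineL2}
    (hf : f ∈ vanishingBelow a) : dilation hr f ∈ vanishingBelow (r⁻¹ * a) := by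
  rw [mem_vanishingBelow] at hf ⊢
  have hq : Measure.QuasiMeasurePreserving (fun t : ℝ => r * t) (volume.restrict (Ioi (0 : ℝ)))
      (volume.restrict (Ioi (0 : ℝ))) := by
    refine ⟨measurable_const_mul r, ?_⟩
    rw [map_mul_left_restrict_Ioi hr]
    exact Measure.smul_absolutelyContinuous
  filter_upwards [hq.ae hf, (memLp_comp_mul_left hr f).coeFn_toLp] with t h1 h2 h3
  rw [dilation, h2]
  refine h1 ?_
  rwa [← lt_inv_mul_iff₀ hr]

theorem dilation_mem_sonineSpace_of_le {a b r : ℝ} (hr : 0 < r) (h1 : a ≤ r⁻¹ * b)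
    (h2 : a ≤ r * b) {f : HalfLineL2} (hf : f ∈ sonineSpace b) :
    dilation hr f ∈ sonineSpace a := by
  have hf' := mem_sonineSpace.1 hf
  have m1 : dilation hr f ∈ vanishingBelow a :=
    vanishingBelow_anti h1 (dilation_mem_vanishingBelow hr hf'.1)
  have m2 : dilation (inv_pos.2 hr) (cosineTransform f) ∈ vanishingBelow a :=
    vanishingBelow_anti (by rwa [inv_inv]) (dilation_mem_vanishingBelow (inv_pos.2 hr) hf'.2)
  have m3 : cosineTransform (dilation hr f) ∈ vanishingBelow a := by
    rw [cosineTransform_dilation]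
    exact Submodule.smul_mem _ _ m2
  exact mem_sonineSpace.2 ⟨m1, m3⟩

/-- A function in `K_b` is dilated into `K_a` for `a ≤ b`. -/
theorem dilation_mem_sonineSpace {a b : ℝ} (ha : 0 < a) (hab : a < b) {f : HalfLineL2}
    (hf : f ∈ sonineSpace b) : dilation (div_pos (ha.trans hab) ha) f ∈ sonineSpace a := by
  have hb := ha.trans hab
  refine dilation_mem_sonineSpace_of_le _ (le_of_eq ?_) ?_ hf
  · field_simp
  -- The transform of the dilated function vanishes below b²/a, which is more than is needed.
  · rw [div_mul_eq_mul_div, le_div_iff₀ ha]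
    nlinarith

/-- With r = b/a, the inverse dilation of u contributes r^s and the measure dt contributes r⁻¹. -/
theorem completedMellin_dilation {a b : ℝ} (ha : 0 < a) (hab : a < b) {f : HalfLineL2}
    (hf : f ∈ sonineSpace b) (s : ℂ) :
    completedMellin (dilation (div_pos (ha.trans hab) ha) f) s
      = ((b / a : ℝ) : ℂ) ^ (s - 1) * completedMellin f s := by
  have hb := ha.trans hab
  have hr : 0 < b / a := div_pos hb ha
  rw [completedMellin_eq ha (dilation_mem_sonineSpace ha hab hf), completedMellin_eq hb hf]
  have e : mellin (theta (dilation hr f)) s = (((b / a : ℝ) : ℂ))⁻¹ • mellin (fun u =>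
      theta f ((b / a)⁻¹ * u)) s := by
    rw [← mellin_const_smul]
    congr 1
    ext u
    rw [theta_dilation, smul_eq_mul]
  have hne : ((b / a : ℝ) : ℂ) ≠ 0 := by exact_mod_cast hr.ne'
  simp only
  rw [e, mellin_comp_mul_left _ _ (inv_pos.2 hr), Complex.ofReal_inv, Complex.inv_cpow _ _ (by
    rw [Complex.arg_ofReal_of_nonneg hr.le]; exact Real.pi_pos.ne), Complex.cpow_neg, inv_inv,
    Complex.cpow_sub _ _ hne, Complex.cpow_one, smul_eq_mul, smul_eq_mul]
  ring

/-! ### Homogeneous kernels -/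

/-- Cauchy–Schwarz for kF = (kp)^{1/2} · (kq)^{1/2} F; the weights p and q = 1/p are the freedom
used in Schur's test. -/
theorem sq_lintegral_mul_le {α : Type*} [MeasurableSpace α] {μ : Measure α} {k p q F : α → ℝ≥0∞}
    (hk : Measurable k) (hp : Measurable p) (hq : Measurable q) (hF : Measurable F)
    (hpq : ∀ᵐ x ∂μ, p x * q x = 1) :
    (∫⁻ x, k x * F x ∂μ) ^ 2 ≤ (∫⁻ x, k x * p x ∂μ) * ∫⁻ x, k x * q x * F x ^ 2 ∂μ := by
  have hh : (2 : ℝ).HolderConjugate 2 := Real.HolderConjugate.two_two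
  have h := ENNReal.lintegral_mul_le_Lp_mul_Lq μ hh
    (f := fun x => (k x * p x) ^ (1 / 2 : ℝ)) (g := fun x => (k x * q x) ^ (1 / 2 : ℝ) * F x)
    (by fun_prop) (by fun_prop)
  have e1 : ∀ᵐ x ∂μ, ((fun x => (k x * p x) ^ (1 / 2 : ℝ)) *
      fun x => (k x * q x) ^ (1 / 2 : ℝ) * F x) x = k x * F x := by
    filter_upwards [hpq] with x hx
    simp only [Pi.mul_apply]
    rw [← mul_assoc, ← ENNReal.mul_rpow_of_nonneg _ _ (by norm_num),
      show k x * p x * (k x * q x) = k x * k x * (p x * q x) by ring, hx, mul_one, ← sq,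
      ← ENNReal.rpow_two, ← ENNReal.rpow_mul]
    norm_num
  have e2 : ∀ x, ((k x * p x) ^ (1 / 2 : ℝ)) ^ (2 : ℝ) = k x * p x := fun x => by
    rw [← ENNReal.rpow_mul]; norm_num
  have e3 : ∀ x, ((k x * q x) ^ (1 / 2 : ℝ) * F x) ^ (2 : ℝ) = k x * q x * F x ^ 2 := fun x => by
    rw [ENNReal.mul_rpow_of_nonneg _ _ (by norm_num), ← ENNReal.rpow_mul, ENNReal.rpow_two]
    norm_num
  rw [lintegral_congr_ae e1] at h
  simp_rw [e2, e3] at h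
  calc _ ≤ _ := pow_le_pow_left₀ zero_le h 2
    _ = _ := by
      rw [mul_pow, ← ENNReal.rpow_two, ← ENNReal.rpow_two, ← ENNReal.rpow_mul, ← ENNReal.rpow_mul]
      norm_num

/-- Schur's test for a kernel dominated by a homogeneous kernel of degree `-1`. -/
theorem memLp_integral_kernel {κ : ℝ → ℝ → ℂ} (hκ : Measurable (Function.uncurry κ))
    {k : ℝ → ℝ≥0∞} (hk : Measurable k)
    (hle : ∀ t > 0, ∀ v > 0, ‖κ t v‖ₑ ≤ ENNReal.ofReal t⁻¹ * k (t⁻¹ * v))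
    (hfin : ∫⁻ r in Ioi (0 : ℝ), k r * ENNReal.ofReal (r ^ (-1 / 2 : ℝ)) ≠ ∞) (f : HalfLineL2) :
    MemLp (fun t => ∫ v in Ioi (0 : ℝ), κ t v * f v) 2 (volume.restrict (Ioi (0 : ℝ))) := by
  set μ := volume.restrict (Ioi (0 : ℝ)) with hμ
  have hfm : Measurable f := (Lp.stronglyMeasurable f).measurable
  have hmeas : AEStronglyMeasurable (fun t => ∫ v, κ t v * f v ∂μ) μ := by
    have : Measurable fun p : ℝ × ℝ => κ p.1 p.2 * f p.2 :=
      Measurable.mul hκ (hfm.comp measurable_snd)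
    exact (this.aestronglyMeasurable (μ := μ.prod μ)).integral_prod_right'
  refine ⟨hmeas, ?_⟩
  rw [eLpNorm_lt_top_iff_lintegral_rpow_enorm_lt_top (by norm_num) (by norm_num)]
  simp only [ENNReal.toReal_ofNat, ENNReal.rpow_two]
  set C := ∫⁻ r, k r * ENNReal.ofReal (r ^ (-1 / 2 : ℝ)) ∂μ with hC
  have h1 : ∀ t > 0, ‖∫ v, κ t v * f v ∂μ‖ₑ ≤ ∫⁻ r, k r * ‖f (t * r)‖ₑ ∂μ := by
    intro t ht
    calc _ ≤ ∫⁻ v, ‖κ t v * f v‖ₑ ∂μ := enorm_integral_le_lintegral_enorm _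
      _ ≤ ∫⁻ v, ENNReal.ofReal t⁻¹ * (k (t⁻¹ * v) * ‖f (t * (t⁻¹ * v))‖ₑ) ∂μ := by
        refine lintegral_mono_ae ?_
        filter_upwards [ae_restrict_mem measurableSet_Ioi] with v hv
        rw [mul_inv_cancel_left₀ ht.ne', enorm_mul, ← mul_assoc]
        gcongr
        exact hle t ht v hv
      _ = ∫⁻ r, k r * ‖f (t * r)‖ₑ ∂μ := by
        rw [lintegral_const_mul _ (by fun_prop), lintegral_comp_mul_left_Ioi (inv_pos.2 ht)
          (fun r => k r * ‖f (t * r)‖ₑ), inv_inv, ← mul_assoc, ← ENNReal.ofReal_mul (by positivity),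
          inv_mul_cancel₀ ht.ne', ENNReal.ofReal_one, one_mul]
  have h2 : ∀ t, (∫⁻ r, k r * ‖f (t * r)‖ₑ ∂μ) ^ 2
      ≤ C * ∫⁻ r, k r * ENNReal.ofReal (r ^ (1 / 2 : ℝ)) * ‖f (t * r)‖ₑ ^ 2 ∂μ := by
    intro t
    -- The weights are r^{-1/2} and r^{1/2}, the exponents balanced for L²(0,∞; dt).
    refine sq_lintegral_mul_le hk (by fun_prop) (by fun_prop) (by fun_prop) ?_
    filter_upwards [ae_restrict_mem measurableSet_Ioi] with r hr
    have hr' : (0 : ℝ) < r := hr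
    rw [← ENNReal.ofReal_mul (by positivity), ← Real.rpow_add hr']
    norm_num
  -- Tonelli: dilating t by r costs r⁻¹, and r^{1/2} r⁻¹ = r^{-1/2} reproduces the constant C.
  have h3 : ∫⁻ t, ∫⁻ r, k r * ENNReal.ofReal (r ^ (1 / 2 : ℝ)) * ‖f (t * r)‖ₑ ^ 2 ∂μ ∂μ
      = C * ∫⁻ t, ‖f t‖ₑ ^ 2 ∂μ := by
    rw [lintegral_lintegral_swap (by
      refine Measurable.aemeasurable ?_
      simp only [Function.uncurry_def]
      fun_prop)]
    rw [hC, ← lintegral_mul_const _ (by fun_prop)]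
    refine lintegral_congr_ae ?_
    filter_upwards [ae_restrict_mem measurableSet_Ioi] with r hr
    have hr' : (0 : ℝ) < r := hr
    have := lintegral_comp_mul_left_Ioi hr' (fun t => ‖f t‖ₑ ^ 2)
    rw [lintegral_const_mul _ (by fun_prop)]
    simp_rw [mul_comm _ r]
    rw [this, ← mul_assoc, mul_assoc (k r), ← ENNReal.ofReal_mul (by positivity)]
    congr 3
    rw [← Real.rpow_neg_one, ← Real.rpow_add hr']
    norm_num
  have h4 : ∫⁻ t, ‖f t‖ₑ ^ 2 ∂μ < ∞ := by
    have := (eLpNorm_lt_top_iff_lintegral_rpow_enorm_lt_top (by norm_num) (by norm_num)).1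
      (Lp.memLp f).2
    simpa using this
  calc _ ≤ ∫⁻ t, C * ∫⁻ r, k r * ENNReal.ofReal (r ^ (1 / 2 : ℝ)) * ‖f (t * r)‖ₑ ^ 2 ∂μ ∂μ := by
        refine lintegral_mono_ae ?_
        filter_upwards [ae_restrict_mem measurableSet_Ioi] with t ht
        exact (pow_le_pow_left₀ zero_le (h1 t ht) 2).trans (h2 t)
    _ = C * (C * ∫⁻ t, ‖f t‖ₑ ^ 2 ∂μ) := by
        rw [lintegral_const_mul' _ _ hfin, h3]
    _ < ∞ := by
        have : C < ∞ := lt_top_iff_ne_top.2 hfin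
        exact ENNReal.mul_lt_top this (ENNReal.mul_lt_top this h4)

/-! ### The Hardy operators -/

/-- The kernel of the Hardy operator `f ↦ t^{w-1} ∫₀^t f(v) v^{-w} dv`. -/
def hardyKernel (w : ℂ) (t v : ℝ) : ℂ := if v < t then (t : ℂ) ^ (w - 1) * (v : ℂ) ^ (-w) else 0

/-- The Hardy operator `f ↦ t^{w-1} ∫₀^t f(v) v^{-w} dv`. -/
def hardy (w : ℂ) (f : HalfLineL2) (t : ℝ) : ℂ := ∫ v in Ioi (0 : ℝ), hardyKernel w t v * f v

/-- The incomplete Gamma function `∫_r^∞ y^{w-1} exp (-π y²) dy`. -/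
def incGamma (w : ℂ) (r : ℝ) : ℂ := ∫ y in Ioi r, (y : ℂ) ^ (w - 1) * (gaussian 1 y : ℂ)

/-- The incomplete Mellin transform `∫_u^∞ x^{w-1} θ_f(x) dx`. -/
def thetaTail (w : ℂ) (f : HalfLineL2) (u : ℝ) : ℂ := ∫ x in Ioi u, (x : ℂ) ^ (w - 1) * theta f x

theorem measurable_hardyKernel (w : ℂ) : Measurable (Function.uncurry (hardyKernel w)) := by
  unfold hardyKernel
  simp only [Function.uncurry_def]
  refine Measurable.ite (measurableSet_lt measurable_snd measurable_fst) ?_ measurable_const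
  fun_prop

/-- Used to split a Gaussian into two equal factors: one absorbs a power or is moved to another
variable, the other ensures convergence. -/
theorem gaussian_sq_div (u t : ℝ) : gaussian (u / √2) t ^ 2 = gaussian u t := by
  rw [gaussian_sq]
  congr 1
  field_simp

theorem gaussian_anti {u s t : ℝ} (hs : 0 ≤ s) (hst : s ≤ t) : gaussian u t ≤ gaussian u s := by
  unfold gaussian
  have : s ^ 2 ≤ t ^ 2 := by gcongr
  have h2 : 0 ≤ Real.pi * u ^ 2 := by positivity
  rw [Real.exp_le_exp]
  nlinarith

theorem exists_rpow_mul_gaussian_le {a u : ℝ} (ha : 0 < a) (hu : 0 < u) (σ : ℝ) :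
    ∃ C, 0 < C ∧ ∀ v, a ≤ v → v ^ σ * gaussian u v ≤ C := by
  obtain ⟨C, hC, h⟩ := exists_exp_neg_sq_le_rpow (c := Real.pi * u ^ 2 * a ^ 2) (by positivity) (-σ)
  refine ⟨C * a ^ σ, by positivity, fun v hv => ?_⟩
  have hv0 : 0 < v := ha.trans_le hv
  have h1 := h (v / a) ((one_le_div ha).2 hv)
  have e : gaussian u v = Real.exp (-(Real.pi * u ^ 2 * a ^ 2) * (v / a) ^ 2) := by
    rw [gaussian]
    congr 1
    field_simp
  rw [e]
  calc _ ≤ v ^ σ * (C * (v / a) ^ (-σ)) := by gcongr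
    _ = C * a ^ σ := by
      rw [Real.rpow_neg (by positivity), Real.div_rpow hv0.le ha.le]
      have := Real.rpow_pos_of_pos hv0 σ
      field_simp

theorem integrable_norm_mul_gaussian (f : HalfLineL2) {u : ℝ} (hu : 0 < u) :
    Integrable (fun v => ‖f v‖ * gaussian u v) (volume.restrict (Ioi (0 : ℝ))) := by
  refine ((Lp.memLp f).integrable_mul (memLp_gaussian_Ioi hu)).norm.congr (.of_forall fun v => ?_)
  simp only [Pi.mul_apply]
  rw [norm_mul, Complex.norm_real, Real.norm_of_nonneg (gaussian_pos _ _).le]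

theorem integrable_norm_mul_rpow_mul_gaussian {a u : ℝ} (ha : 0 < a) (hu : 0 < u) (σ : ℝ)
    {f : HalfLineL2} (hf : f ∈ vanishingBelow a) :
    Integrable (fun v => ‖f v‖ * (v ^ σ * gaussian u v)) (volume.restrict (Ioi (0 : ℝ))) := by
  have hu2 : 0 < u / √2 := by positivity
  obtain ⟨C, hC, h⟩ := exists_rpow_mul_gaussian_le ha hu2 σ
  refine ((integrable_norm_mul_gaussian f hu2).const_mul C).mono' ?_ ?_
  · refine (Lp.aestronglyMeasurable f).norm.mul (Measurable.aestronglyMeasurable ?_)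
    exact Measurable.mul (by fun_prop) (continuous_gaussian u).measurable
  · filter_upwards [mem_vanishingBelow.1 hf, ae_restrict_mem measurableSet_Ioi] with v hv hv0
    have hv0' : (0 : ℝ) < v := hv0
    by_cases hva : v < a
    · simp [hv hva]
    · have h1 := h v (not_lt.1 hva)
      have hg := gaussian_pos (u / √2) v
      rw [Real.norm_of_nonneg (mul_nonneg (norm_nonneg _)
        (mul_nonneg (by positivity) (gaussian_pos u v).le)), ← gaussian_sq_div]
      calc _ = ‖f v‖ * gaussian (u / √2) v * (v ^ σ * gaussian (u / √2) v) := by ring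
        _ ≤ ‖f v‖ * gaussian (u / √2) v * C := by gcongr
        _ = _ := by ring

theorem integrableOn_rpow_mul_gaussian {a u : ℝ} (ha : 0 < a) (hu : 0 < u) (σ : ℝ) :
    IntegrableOn (fun v => v ^ σ * gaussian u v) (Ioi a) := by
  have hu2 : 0 < u / √2 := by positivity
  obtain ⟨C, hC, h⟩ := exists_rpow_mul_gaussian_le ha hu2 σ
  refine ((integrable_gaussian hu2).integrableOn.const_mul C).mono' ?_ ?_
  · exact (Measurable.mul (by fun_prop) (continuous_gaussian u).measurable).aestronglyMeasurable
  · filter_upwards [ae_restrict_mem measurableSet_Ioi] with v hv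
    have hv' : a < v := hv
    have hv0 : 0 < v := ha.trans hv
    have hg := gaussian_pos (u / √2) v
    rw [Real.norm_of_nonneg (mul_nonneg (by positivity) (gaussian_pos u v).le), ← gaussian_sq_div]
    calc _ = v ^ σ * gaussian (u / √2) v * gaussian (u / √2) v := by ring
      _ ≤ C * gaussian (u / √2) v := by gcongr; exact h v hv'.le

theorem integral_Ioi_cpow_mul_gaussian (w : ℂ) {u v : ℝ} (hu : 0 ≤ u) (hv : 0 < v) :
    ∫ x in Ioi u, (x : ℂ) ^ (w - 1) * (gaussian x v : ℂ) = (v : ℂ) ^ (-w) * incGamma w (v * u) := by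
  have h := integral_comp_mul_left_Ioi (fun y : ℝ => (y : ℂ) ^ (w - 1) * (gaussian 1 y : ℂ)) u hv
  have hv' : (v : ℂ) ≠ 0 := by exact_mod_cast hv.ne'
  have e : ∫ x in Ioi u, ((v * x : ℝ) : ℂ) ^ (w - 1) * (gaussian 1 (v * x) : ℂ)
      = (v : ℂ) ^ (w - 1) * ∫ x in Ioi u, (x : ℂ) ^ (w - 1) * (gaussian x v : ℂ) := by
    rw [← integral_const_mul]
    refine setIntegral_congr_fun measurableSet_Ioi fun x hx => ?_
    have hx0 : 0 ≤ x := hu.trans (le_of_lt hx)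
    rw [Complex.ofReal_mul, Complex.mul_cpow_ofReal_nonneg hv.le hx0, mul_assoc]
    congr 3
    unfold gaussian
    ring_nf
  rw [e, Complex.real_smul, ← incGamma] at h
  have hw : (v : ℂ) ^ w ≠ 0 := by simp [Complex.cpow_eq_zero_iff, hv']
  have hw1 : (v : ℂ) ^ (w - 1) ≠ 0 := by simp [Complex.cpow_eq_zero_iff, hv']
  refine mul_left_cancel₀ hw1 (h.trans ?_)
  rw [Complex.cpow_neg, Complex.cpow_sub _ _ hv', Complex.cpow_one]
  push_cast
  field_simp

theorem norm_cpow_of_pos {t : ℝ} (ht : 0 < t) (w : ℂ) : ‖(t : ℂ) ^ w‖ = t ^ w.re :=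
  Complex.norm_cpow_eq_rpow_re_of_pos ht w

/-- The incomplete Mellin transform as an integral against the incomplete Gamma function. -/
theorem thetaTail_eq {a : ℝ} (ha : 0 < a) (w : ℂ) {f : HalfLineL2} (hf : f ∈ vanishingBelow a)
    {u : ℝ} (hu : 0 < u) :
    Integrable (fun v => f v * ((v : ℂ) ^ (-w) * incGamma w (v * u))) (volume.restrict (Ioi (0 : ℝ)))
    ∧ thetaTail w f u = ∫ v in Ioi (0 : ℝ), f v * ((v : ℂ) ^ (-w) * incGamma w (v * u)) := by
  set μ := volume.restrict (Ioi (0 : ℝ)) with hμ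
  set ν := volume.restrict (Ioi u) with hν
  have hint : Integrable (fun p : ℝ × ℝ => (p.1 : ℂ) ^ (w - 1) * (f p.2 * (gaussian p.1 p.2 : ℂ)))
      (ν.prod μ) := by
    -- For x ≥ u and v ≥ a, x²v² ≥ (a²x² + u²v²)/2, so the joint Gaussian is dominated by a product
    -- of Gaussians.
    have hb := Integrable.mul_prod (μ := ν) (ν := μ)
      (integrableOn_rpow_mul_gaussian hu (u := a / √2) (by positivity) (w.re - 1))
      (integrable_norm_mul_gaussian f (u := u / √2) (by positivity))
    refine hb.mono' ?_ ?_
    · refine AEStronglyMeasurable.mul ?_ (AEStronglyMeasurable.mul ?_ ?_)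
      · exact (by fun_prop : Measurable fun p : ℝ × ℝ => (p.1 : ℂ) ^ (w - 1)).aestronglyMeasurable
      · exact (Lp.aestronglyMeasurable f).comp_snd
      · exact measurable_gaussian_uncurry.aestronglyMeasurable
    · have h1 : ∀ᵐ p ∂(ν.prod μ), p.1 ∈ Ioi u :=
        Measure.quasiMeasurePreserving_fst.ae (ae_restrict_mem measurableSet_Ioi)
      have h2 : ∀ᵐ p ∂(ν.prod μ), p.2 < a → f p.2 = 0 :=
        Measure.quasiMeasurePreserving_snd.ae (mem_vanishingBelow.1 hf)
      filter_upwards [h1, h2] with p hp1 hp2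
      have hp1' : u < p.1 := hp1
      have hp0 : 0 < p.1 := hu.trans hp1
      by_cases hpa : p.2 < a
      · simp [hp2 hpa]
      · have hpa' := not_lt.1 hpa
        rw [norm_mul, norm_mul, norm_cpow_of_pos hp0, Complex.norm_real,
          Real.norm_of_nonneg (gaussian_pos _ _).le, Complex.sub_re, Complex.one_re]
        have hg : gaussian p.1 p.2 ≤ gaussian (a / √2) p.1 * gaussian (u / √2) p.2 := by
          unfold gaussian
          rw [← Real.exp_add, Real.exp_le_exp, div_pow, div_pow, Real.sq_sqrt (by norm_num)]
          have e1 : a ^ 2 ≤ p.2 ^ 2 := by gcongr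
          have e2 : u ^ 2 ≤ p.1 ^ 2 := by gcongr
          have e3 : 0 ≤ p.1 ^ 2 * (p.2 ^ 2 - a ^ 2) := mul_nonneg (sq_nonneg _) (by linarith)
          have e4 : 0 ≤ p.2 ^ 2 * (p.1 ^ 2 - u ^ 2) := mul_nonneg (sq_nonneg _) (by linarith)
          have e5 : a ^ 2 * p.1 ^ 2 / 2 + u ^ 2 * p.2 ^ 2 / 2 ≤ p.1 ^ 2 * p.2 ^ 2 := by nlinarith
          have := mul_le_mul_of_nonneg_left e5 Real.pi_pos.le
          linarith
        calc _ ≤ p.1 ^ (w.re - 1) * (‖f p.2‖ * (gaussian (a / √2) p.1 * gaussian (u / √2) p.2)) := by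
              gcongr
          _ = _ := by ring
  have hin : ∀ v ∈ Ioi (0 : ℝ), ∫ x, (x : ℂ) ^ (w - 1) * (f v * (gaussian x v : ℂ)) ∂ν
      = f v * ((v : ℂ) ^ (-w) * incGamma w (v * u)) := fun v hv => by
    rw [← integral_Ioi_cpow_mul_gaussian w hu.le hv, ← integral_const_mul]
    refine integral_congr_ae (.of_forall fun x => ?_)
    simp only
    ring
  constructor
  · refine hint.integral_prod_right.congr ?_
    filter_upwards [ae_restrict_mem measurableSet_Ioi] with v hv
    exact hin v hv
  · have h1 : thetaTail w f u = ∫ x, ∫ v, (x : ℂ) ^ (w - 1) * (f v * (gaussian x v : ℂ)) ∂μ ∂ν := by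
      refine integral_congr_ae (.of_forall fun x => ?_)
      simp only
      rw [integral_const_mul, theta]
    rw [h1, integral_integral_swap hint]
    exact setIntegral_congr_fun measurableSet_Ioi hin

theorem norm_hardyKernel_mul_le {a : ℝ} {w : ℂ} {f : HalfLineL2} {t v : ℝ} (hv : 0 < v)
    (ha : 0 < a) (hva : v < a → f v = 0) :
    ‖hardyKernel w t v * f v‖
      ≤ (Ioi a).indicator (fun t => t ^ (w.re - 1)) t * (‖f v‖ * v ^ (-w.re)) := by
  unfold hardyKernel
  by_cases h : v < t
  · by_cases h2 : v < a
    · simp [hva h2]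
    · have h3 : a < t := (not_lt.1 h2).trans_lt h
      have ht : 0 < t := ha.trans h3
      rw [if_pos h, indicator_of_mem (show t ∈ Ioi a from h3), norm_mul, norm_mul,
        norm_cpow_of_pos ht, norm_cpow_of_pos hv, Complex.sub_re, Complex.one_re, Complex.neg_re]
      exact le_of_eq (by ring)
  · rw [if_neg h, zero_mul, norm_zero]
    refine mul_nonneg (indicator_nonneg (fun t ht => ?_) t) (by positivity)
    have : 0 < t := ha.trans ht
    positivity

theorem integrable_hardyKernel_mul {a : ℝ} (ha : 0 < a) (w : ℂ) {f : HalfLineL2}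
    (hf : f ∈ vanishingBelow a) (t : ℝ) :
    Integrable (fun v => hardyKernel w t v * f v) (volume.restrict (Ioi (0 : ℝ))) := by
  -- Only v < t contributes, and there the Gaussian at v is at least the one at t; dividing by the
  -- latter gives a valid bound.
  refine ((integrable_norm_mul_rpow_mul_gaussian ha one_pos (-w.re) hf).const_mul
    ((Ioi a).indicator (fun t => t ^ (w.re - 1)) t / gaussian 1 t)).mono' ?_ ?_
  · refine AEStronglyMeasurable.mul (Measurable.aestronglyMeasurable ?_) (Lp.aestronglyMeasurable f)
    exact (measurable_hardyKernel w).comp (measurable_const.prodMk measurable_id)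
  · filter_upwards [mem_vanishingBelow.1 hf, ae_restrict_mem measurableSet_Ioi] with v hv hv0
    have hv0' : (0 : ℝ) < v := hv0
    have h := norm_hardyKernel_mul_le (w := w) (t := t) hv0' ha hv
    have hnn : 0 ≤ (Ioi a).indicator (fun t => t ^ (w.re - 1)) t := by
      refine indicator_nonneg (fun t ht => ?_) t
      have : 0 < t := ha.trans ht
      positivity
    have hgt := gaussian_pos 1 t
    by_cases hvt : v < t
    · refine h.trans ?_
      have hg := gaussian_anti (u := 1) hv0'.le hvt.le
      calc _ = (Ioi a).indicator (fun t => t ^ (w.re - 1)) t / gaussian 1 t *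
            (‖f v‖ * (v ^ (-w.re) * gaussian 1 t)) := by field_simp
        _ ≤ _ := by gcongr
    · rw [hardyKernel, if_neg hvt, zero_mul, norm_zero]
      have := gaussian_pos 1 v
      positivity

/-- The Gaussian transform of a Hardy transform. -/
theorem integral_hardy_mul_gaussian {a : ℝ} (ha : 0 < a) (w : ℂ) {f : HalfLineL2}
    (hf : f ∈ vanishingBelow a) {u : ℝ} (hu : 0 < u) :
    ∫ t in Ioi (0 : ℝ), hardy w f t * (gaussian u t : ℂ) = (u : ℂ) ^ (-w) * thetaTail w f u := by
  set μ := volume.restrict (Ioi (0 : ℝ)) with hμ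
  have hu2 : 0 < u / √2 := by positivity
  have hint : Integrable (fun p : ℝ × ℝ => (hardyKernel w p.1 p.2 * f p.2) * (gaussian u p.1 : ℂ))
      (μ.prod μ) := by
    have hi : Integrable (fun t : ℝ => (Ioi a).indicator (fun t => t ^ (w.re - 1)) t *
        gaussian (u / √2) t) μ := by
      refine Integrable.integrableOn ?_
      have e : (fun t : ℝ => (Ioi a).indicator (fun t => t ^ (w.re - 1)) t * gaussian (u / √2) t)
          = (Ioi a).indicator fun t => t ^ (w.re - 1) * gaussian (u / √2) t := by
        ext t
        by_cases h : t ∈ Ioi a <;> simp [h]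
      rw [e, integrable_indicator_iff measurableSet_Ioi]
      exact integrableOn_rpow_mul_gaussian ha hu2 _
    -- Since v < t, one of the two factors of the Gaussian in t can be replaced by the larger
    -- Gaussian in v.
    have hb := hi.mul_prod (integrable_norm_mul_rpow_mul_gaussian ha hu2 (-w.re) hf)
    refine hb.mono' ?_ ?_
    · refine AEStronglyMeasurable.mul (AEStronglyMeasurable.mul ?_ ?_) ?_
      · exact (measurable_hardyKernel w).aestronglyMeasurable
      · exact (Lp.aestronglyMeasurable f).comp_snd
      · exact (Complex.continuous_ofReal.comp
          ((continuous_gaussian u).comp continuous_fst)).aestronglyMeasurable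
    · have h1 : ∀ᵐ p ∂(μ.prod μ), p.2 ∈ Ioi (0 : ℝ) :=
        Measure.quasiMeasurePreserving_snd.ae (ae_restrict_mem measurableSet_Ioi)
      have h2 : ∀ᵐ p ∂(μ.prod μ), p.2 < a → f p.2 = 0 :=
        Measure.quasiMeasurePreserving_snd.ae (mem_vanishingBelow.1 hf)
      filter_upwards [h1, h2] with p hp1 hp2
      have hp0 : 0 < p.2 := hp1
      have hnn : 0 ≤ (Ioi a).indicator (fun t => t ^ (w.re - 1)) p.1 := by
        refine indicator_nonneg (fun t ht => ?_) _
        have : 0 < t := ha.trans ht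
        positivity
      have hg2 := gaussian_pos (u / √2) p.2
      have hg1 := gaussian_pos (u / √2) p.1
      by_cases hlt : p.2 < p.1
      · rw [norm_mul, Complex.norm_real, Real.norm_of_nonneg (gaussian_pos _ _).le,
          ← gaussian_sq_div, sq]
        calc _ ≤ ((Ioi a).indicator (fun t => t ^ (w.re - 1)) p.1 * (‖f p.2‖ * p.2 ^ (-w.re)))
              * (gaussian (u / √2) p.1 * gaussian (u / √2) p.2) := by
              refine mul_le_mul (norm_hardyKernel_mul_le hp0 ha hp2) ?_ (by positivity)
                (by positivity)
              gcongr
              exact gaussian_anti hp0.le hlt.le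
          _ = _ := by ring
      · rw [hardyKernel, if_neg hlt, zero_mul, zero_mul, norm_zero]
        positivity
  have h1 : ∫ t in Ioi (0 : ℝ), hardy w f t * (gaussian u t : ℂ)
      = ∫ t, ∫ v, (hardyKernel w t v * f v) * (gaussian u t : ℂ) ∂μ ∂μ := by
    refine integral_congr_ae (.of_forall fun t => ?_)
    simp only
    rw [integral_mul_const, hardy]
  rw [h1, integral_integral_swap hint, (thetaTail_eq ha w hf hu).2, ← integral_const_mul]
  refine setIntegral_congr_fun measurableSet_Ioi fun v hv => ?_
  have hv0 : (0 : ℝ) < v := hv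
  have e : ∀ t : ℝ, hardyKernel w t v * f v * (gaussian u t : ℂ) = (Ioi v).indicator
      (fun t : ℝ => (f v * (v : ℂ) ^ (-w)) * ((t : ℂ) ^ (w - 1) * (gaussian t u : ℂ))) t := by
    intro t
    rw [hardyKernel, gaussian_comm]
    by_cases h : v < t
    · rw [if_pos h, indicator_of_mem (show t ∈ Ioi v from h)]
      ring
    · rw [if_neg h, indicator_of_notMem (show t ∉ Ioi v from h)]
      ring
  simp_rw [e]
  rw [integral_indicator measurableSet_Ioi, hμ, Measure.restrict_restrict measurableSet_Ioi,
    inter_eq_left.2 (Ioi_subset_Ioi hv0.le), integral_const_mul,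
    integral_Ioi_cpow_mul_gaussian w hv0.le hu, mul_comm u v]
  ring

/-! ### The incomplete Mellin transform -/

theorem integrableOn_cpow_mul_theta {a : ℝ} (ha : 0 < a) (w : ℂ) {f : HalfLineL2}
    (hf : f ∈ sonineSpace a) : IntegrableOn (fun x : ℝ => (x : ℂ) ^ (w - 1) * theta f x) (Ioi 0) :=
  mellinConvergent_theta ha hf w

theorem hasDerivAt_thetaTail {a : ℝ} (ha : 0 < a) (w : ℂ) {f : HalfLineL2}
    (hf : f ∈ sonineSpace a) {u : ℝ} (hu : 0 < u) :
    HasDerivAt (thetaTail w f) (-((u : ℂ) ^ (w - 1) * theta f u)) u := by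
  set g : ℝ → ℂ := fun x => (x : ℂ) ^ (w - 1) * theta f x with hg
  have hgi : IntegrableOn g (Ioi 0) := integrableOn_cpow_mul_theta ha w hf
  have hgc : ContinuousOn g (Ioi 0) := by
    refine ContinuousOn.mul (fun x hx => ?_) (continuousOn_theta f)
    exact (Complex.continuousAt_ofReal_cpow_const _ _ (Or.inr (ne_of_gt hx))).continuousWithinAt
  have h1 : HasDerivAt (fun x => ∫ y in u..x, g y) (g u) u := by
    refine intervalIntegral.integral_hasDerivAt_right (by simp) ?_
      (hgc.continuousAt (Ioi_mem_nhds hu))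
    exact hgc.stronglyMeasurableAtFilter isOpen_Ioi u hu
  refine (h1.const_sub (thetaTail w f u)).congr_of_eventuallyEq ?_
  filter_upwards [Ioi_mem_nhds hu] with x hx
  have hi : ∀ y : ℝ, 0 < y → IntegrableOn g (Ioi y) := fun y hy =>
    hgi.mono_set (Ioi_subset_Ioi hy.le)
  rw [← intervalIntegral.integral_Ioi_sub_Ioi' (hi u hu) (hi x hx)]
  simp [thetaTail, hg]

theorem continuousOn_thetaTail {a : ℝ} (ha : 0 < a) (w : ℂ) {f : HalfLineL2}
    (hf : f ∈ sonineSpace a) : ContinuousOn (thetaTail w f) (Ioi 0) := fun _ hu =>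
  (hasDerivAt_thetaTail ha w hf hu).continuousAt.continuousWithinAt

theorem thetaTail_add {a : ℝ} (ha : 0 < a) (w : ℂ) {f : HalfLineL2} (hf : f ∈ sonineSpace a)
    {u : ℝ} (hu : 0 < u) :
    (∫ x in Ioc 0 u, (x : ℂ) ^ (w - 1) * theta f x) + thetaTail w f u = mellin (theta f) w := by
  have hgi := integrableOn_cpow_mul_theta ha w hf
  rw [thetaTail, ← setIntegral_union Ioc_disjoint_Ioi_same measurableSet_Ioi
    (hgi.mono_set Ioc_subset_Ioi_self) (hgi.mono_set (Ioi_subset_Ioi hu.le)),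
    Ioc_union_Ioi_eq_Ioi hu.le]
  rfl

theorem norm_cpow_mul_theta_le {w : ℂ} {f : HalfLineL2} {C r x : ℝ} (hx : 0 < x)
    (h : ‖theta f x‖ ≤ C * ‖f‖ * x ^ (r - w.re)) :
    ‖(x : ℂ) ^ (w - 1) * theta f x‖ ≤ C * ‖f‖ * x ^ (r - 1) := by
  rw [norm_mul, norm_cpow_of_pos hx, Complex.sub_re, Complex.one_re]
  calc _ ≤ x ^ (w.re - 1) * (C * ‖f‖ * x ^ (r - w.re)) := by gcongr
    _ = C * ‖f‖ * x ^ ((w.re - 1) + (r - w.re)) := by rw [Real.rpow_add hx]; ring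
    _ = _ := by ring_nf

/-- For r < 0 the tail is estimated directly. For r > 0 the zero at w makes it minus the integral
over (0,u], which is small near 0. Rapid decay at both ends is what makes the later boundary terms
and integrals harmless. -/
theorem exists_norm_thetaTail_le {a : ℝ} (ha : 0 < a) {w : ℂ} {f : HalfLineL2}
    (hf : f ∈ sonineSpace a) (hw : mellin (theta f) w = 0) {r : ℝ} (hr : r ≠ 0) :
    ∃ C, 0 ≤ C ∧ ∀ u : ℝ, 0 < u → ‖thetaTail w f u‖ ≤ C * u ^ r := by
  obtain ⟨C, hC, h⟩ := exists_norm_theta_le ha (r - w.re)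
  refine ⟨C * ‖f‖ * |r|⁻¹, by positivity, fun u hu => ?_⟩
  rcases lt_or_gt_of_ne hr with hr | hr
  · calc _ ≤ ∫ x in Ioi u, C * ‖f‖ * x ^ (r - 1) := by
          refine norm_integral_le_of_norm_le
            ((integrableOn_Ioi_rpow_of_lt (by linarith) hu).const_mul _) ?_
          filter_upwards [ae_restrict_mem measurableSet_Ioi] with x hx
          have hx0 : 0 < x := hu.trans hx
          exact norm_cpow_mul_theta_le hx0 (h f hf x hx0)
      _ = _ := by
        rw [integral_const_mul, integral_Ioi_rpow_of_lt (by linarith) hu, abs_of_neg hr,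
          sub_add_cancel]
        field_simp
  · have e : thetaTail w f u = -∫ x in Ioc 0 u, (x : ℂ) ^ (w - 1) * theta f x := by
      rw [eq_neg_iff_add_eq_zero, add_comm, thetaTail_add ha w hf hu, hw]
    rw [e, norm_neg]
    have hi : IntervalIntegrable (fun x : ℝ => x ^ (r - 1)) volume 0 u :=
      intervalIntegral.intervalIntegrable_rpow' (by linarith)
    calc _ ≤ ∫ x in Ioc 0 u, C * ‖f‖ * x ^ (r - 1) := by
          refine norm_integral_le_of_norm_le
            (((intervalIntegrable_iff_integrableOn_Ioc_of_le hu.le).1 hi).const_mul _) ?_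
          filter_upwards [ae_restrict_mem measurableSet_Ioc] with x hx
          exact norm_cpow_mul_theta_le hx.1 (h f hf x hx.1)
      _ = _ := by
        rw [integral_const_mul, ← intervalIntegral.integral_of_le hu.le,
          integral_rpow (Or.inl (by linarith)), sub_add_cancel, Real.zero_rpow hr.ne',
          abs_of_pos hr, sub_zero]
        field_simp

/-! ### Square integrability of Hardy transforms -/

theorem integrableOn_Ioi_of_pieces {g : ℝ → ℝ} {p q C₁ C₂ : ℝ} (hp : -1 < p) (hq : q < -1)
    (h1 : ∀ r, 0 < r → r < 1 → g r = C₁ * r ^ p) (h2 : ∀ r, 1 ≤ r → g r = C₂ * r ^ q) :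
    IntegrableOn g (Ioi 0) := by
  rw [← Ioo_union_Ici_eq_Ioi (zero_lt_one' ℝ)]
  refine IntegrableOn.union ?_ ?_
  · refine IntegrableOn.congr_fun (f := fun r => C₁ * r ^ p) ?_ (fun r hr => (h1 r hr.1 hr.2).symm)
      measurableSet_Ioo
    exact ((intervalIntegral.integrableOn_Ioo_rpow_iff zero_lt_one).2 hp).const_mul _
  · refine IntegrableOn.congr_fun (f := fun r => C₂ * r ^ q) ?_ (fun r hr => (h2 r hr).symm)
      measurableSet_Ici
    rw [integrableOn_Ici_iff_integrableOn_Ioi]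
    exact (integrableOn_Ioi_rpow_of_lt hq one_pos).const_mul _

theorem memLp_integral_kernel_of_real {κ : ℝ → ℝ → ℂ} (hκ : Measurable (Function.uncurry κ))
    {k : ℝ → ℝ} (hk : Measurable k)
    (hle : ∀ t > 0, ∀ v > 0, ‖κ t v‖ ≤ t⁻¹ * k (t⁻¹ * v))
    (hint : IntegrableOn (fun r => k r * r ^ (-1 / 2 : ℝ)) (Ioi 0)) (f : HalfLineL2) :
    MemLp (fun t => ∫ v in Ioi (0 : ℝ), κ t v * f v) 2 (volume.restrict (Ioi (0 : ℝ))) := by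
  refine memLp_integral_kernel hκ (k := fun r => ENNReal.ofReal (k r)) (by fun_prop) ?_ ?_ f
  · intro t ht v hv
    rw [← ENNReal.ofReal_mul (by positivity), ← ofReal_norm]
    exact ENNReal.ofReal_le_ofReal (hle t ht v hv)
  · refine ne_of_lt (lt_of_le_of_lt (lintegral_mono_ae ?_) hint.lintegral_lt_top)
    filter_upwards [ae_restrict_mem measurableSet_Ioi] with r hr
    have hr' : (0 : ℝ) < r := hr
    rw [ENNReal.ofReal_mul' (by positivity)]

/-- The kernel is homogeneous of degree -1 with profile r^{-w} on (0,1), so Schur's integral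
converges exactly because Re w < 1/2. No zero of M(f) enters. -/
theorem memLp_hardy_of_re_lt {w : ℂ} (hw : w.re < 1 / 2) (f : HalfLineL2) :
    MemLp (hardy w f) 2 (volume.restrict (Ioi (0 : ℝ))) := by
  refine memLp_integral_kernel_of_real (measurable_hardyKernel w)
    (k := fun r => if r < 1 then r ^ (-w.re) else 0) ?_ ?_ ?_ f
  · exact Measurable.ite measurableSet_Iio (by fun_prop) measurable_const
  · intro t ht v hv
    have e : t⁻¹ * v < 1 ↔ v < t := by rw [inv_mul_lt_iff₀ ht, mul_one]
    simp only [e]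
    unfold hardyKernel
    split_ifs with h
    · rw [norm_mul, norm_cpow_of_pos ht, norm_cpow_of_pos hv, Complex.sub_re, Complex.one_re,
        Complex.neg_re, Real.mul_rpow (by positivity) hv.le, Real.inv_rpow ht.le,
        Real.rpow_neg ht.le, inv_inv, Real.rpow_sub_one ht.ne']
      exact le_of_eq (by ring)
    · simp
  · refine integrableOn_Ioi_of_pieces (p := -w.re + -1 / 2) (q := -2) (C₁ := 1) (C₂ := 0)
      (by linarith) (by norm_num) (fun r h0 h1 => ?_) (fun r h1 => ?_)
    · simp only [if_pos h1]
      rw [Real.rpow_add h0, one_mul]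
    · simp [not_lt.2 h1]

/-! ### Comparison of the Hardy kernel with the incomplete Gamma function. -/

theorem integrableOn_rpow_mul_gaussian_one {σ : ℝ} (hσ : 0 < σ) :
    IntegrableOn (fun y : ℝ => y ^ (σ - 1) * gaussian 1 y) (Ioi 0) := by
  simp_rw [gaussian_comm 1]
  exact (integral_rpow_mul_gaussian hσ one_pos).1

theorem norm_cpow_mul_gaussian {w : ℂ} {y : ℝ} (hy : 0 < y) :
    ‖(y : ℂ) ^ (w - 1) * (gaussian 1 y : ℂ)‖ = y ^ (w.re - 1) * gaussian 1 y := by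
  rw [norm_mul, norm_cpow_of_pos hy, Complex.norm_real, Real.norm_of_nonneg (gaussian_pos _ _).le,
    Complex.sub_re, Complex.one_re]

theorem integrableOn_cpow_mul_gaussian {w : ℂ} (hw : 0 < w.re) :
    IntegrableOn (fun y : ℝ => (y : ℂ) ^ (w - 1) * (gaussian 1 y : ℂ)) (Ioi 0) := by
  refine (integrableOn_rpow_mul_gaussian_one hw).mono' (Measurable.aestronglyMeasurable ?_) ?_
  · exact Measurable.mul (by fun_prop)
      (Complex.measurable_ofReal.comp (continuous_gaussian 1).measurable)
  · filter_upwards [ae_restrict_mem measurableSet_Ioi] with y hy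
    exact (norm_cpow_mul_gaussian hy).le

theorem incGamma_zero {w : ℂ} (hw : 0 < w.re) : incGamma w 0 = Complex.Gammaℝ w / 2 := by
  have h := mellin_gaussian hw one_pos
  simp only [Complex.ofReal_one, Complex.one_cpow, mul_one] at h
  rw [← h, incGamma]
  simp_rw [gaussian_comm 1]

theorem measurable_incGamma (w : ℂ) : Measurable (incGamma w) := by
  set F : ℝ × ℝ → ℂ := fun p => if p.1 < p.2 then
    (p.2 : ℂ) ^ (w - 1) * (gaussian 1 p.2 : ℂ) else 0 with hF
  have e : incGamma w = fun r => ∫ y, F (r, y) := by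
    ext r
    rw [incGamma, ← integral_indicator measurableSet_Ioi]
    rfl
  have hm : Measurable F := by
    refine Measurable.ite (measurableSet_lt measurable_fst measurable_snd) ?_ measurable_const
    exact Measurable.mul (by fun_prop)
      (Complex.measurable_ofReal.comp ((continuous_gaussian 1).measurable.comp measurable_snd))
  rw [e]
  exact hm.stronglyMeasurable.integral_prod_right'.measurable

/-- These are the two regimes of the comparison kernel in `memLp_hardy_of_re_pos`: below the
diagonal the value at 0 is subtracted, above it only decay is needed. -/
theorem exists_norm_incGamma_le {w : ℂ} (hw : 0 < w.re) : ∃ C, 0 < C ∧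
    (∀ r, 0 < r → ‖incGamma w 0 - incGamma w r‖ ≤ C * r ^ w.re) ∧
    ∀ r, 1 ≤ r → ‖incGamma w r‖ ≤ C * r⁻¹ := by
  obtain ⟨C, hC, h⟩ := exists_rpow_mul_gaussian_le one_pos one_pos (w.re + 1)
  refine ⟨C + w.re⁻¹, by positivity, fun r hr => ?_, fun r hr => ?_⟩
  · have hi := integrableOn_cpow_mul_gaussian hw
    have hii : IntervalIntegrable (fun x : ℝ => x ^ (w.re - 1)) volume 0 r :=
      intervalIntegral.intervalIntegrable_rpow' (by linarith)
    rw [incGamma, incGamma, intervalIntegral.integral_Ioi_sub_Ioi hi hr.le,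
      intervalIntegral.integral_of_le hr.le]
    calc _ ≤ ∫ x in Ioc 0 r, x ^ (w.re - 1) := by
          refine norm_integral_le_of_norm_le
            ((intervalIntegrable_iff_integrableOn_Ioc_of_le hr.le).1 hii) ?_
          filter_upwards [ae_restrict_mem measurableSet_Ioc] with y hy
          rw [norm_cpow_mul_gaussian hy.1]
          have hy0 := hy.1
          refine mul_le_of_le_one_right (by positivity) ?_
          have := gaussian_anti (u := 1) le_rfl hy0.le
          simpa [gaussian] using this
      _ = w.re⁻¹ * r ^ w.re := by
        rw [← intervalIntegral.integral_of_le hr.le, integral_rpow (Or.inl (by linarith)),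
          sub_add_cancel, Real.zero_rpow hw.ne', sub_zero]
        ring
      _ ≤ _ := by
        gcongr
        linarith
  · have hr0 : 0 < r := by linarith
    calc _ ≤ ∫ y in Ioi r, C * y ^ (-2 : ℝ) := by
          refine norm_integral_le_of_norm_le
            ((integrableOn_Ioi_rpow_of_lt (by norm_num) hr0).const_mul _) ?_
          filter_upwards [ae_restrict_mem measurableSet_Ioi] with y hy
          have hy0 : 0 < y := hr0.trans hy
          rw [norm_cpow_mul_gaussian hy0]
          have := h y (hr.trans (le_of_lt hy))
          calc _ = (y ^ (w.re + 1) * gaussian 1 y) * y ^ (-2 : ℝ) := by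
                rw [show w.re - 1 = (w.re + 1) + (-2) by ring, Real.rpow_add hy0]; ring
            _ ≤ _ := by gcongr
      _ = C * r⁻¹ := by
        rw [integral_const_mul, integral_Ioi_rpow_of_lt (by norm_num) hr0]
        norm_num [Real.rpow_neg_one]
      _ ≤ _ := by
        gcongr
        linarith [inv_pos.2 hw]

theorem memLp_cpow_mul_thetaTail {a : ℝ} (ha : 0 < a) {w : ℂ} {f : HalfLineL2}
    (hf : f ∈ sonineSpace a) (hw : mellin (theta f) w = 0) :
    MemLp (fun t : ℝ => (t : ℂ) ^ (w - 1) * thetaTail w f t⁻¹) 2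
      (volume.restrict (Ioi (0 : ℝ))) := by
  have hcont : ContinuousOn (fun t : ℝ => (t : ℂ) ^ (w - 1) * thetaTail w f t⁻¹) (Ioi 0) := by
    refine ContinuousOn.mul (fun x hx => ?_) ?_
    · exact (Complex.continuousAt_ofReal_cpow_const _ _ (Or.inr (ne_of_gt hx))).continuousWithinAt
    · refine (continuousOn_thetaTail ha w hf).comp (fun x hx => ?_) fun x hx => ?_
      · exact (continuousAt_inv₀ (ne_of_gt hx)).continuousWithinAt
      · exact inv_pos.2 (mem_Ioi.1 hx)
  -- Large enough that Re w - 1 + q ≥ 0, giving boundedness for t < 1, and Re w - 1 - q ≤ -2, giving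
  -- decay for t ≥ 1.
  have hq : 0 < |w.re| + 1 := by positivity
  obtain ⟨C₁, hC₁, h₁⟩ := exists_norm_thetaTail_le ha hf hw (neg_ne_zero.2 hq.ne')
  obtain ⟨C₂, hC₂, h₂⟩ := exists_norm_thetaTail_le ha hf hw hq.ne'
  rw [memLp_two_iff_integrable_sq_norm (hcont.aestronglyMeasurable measurableSet_Ioi)]
  have hi : IntegrableOn (fun t : ℝ => if t < 1 then C₁ ^ 2 * t ^ (0 : ℝ)
      else C₂ ^ 2 * t ^ (-4 : ℝ)) (Ioi 0) :=
    integrableOn_Ioi_of_pieces (p := 0) (q := -4) (C₁ := C₁ ^ 2) (C₂ := C₂ ^ 2) (by norm_num)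
      (by norm_num) (fun r _ h1 => if_pos h1) (fun r h1 => if_neg (not_lt.2 h1))
  refine hi.mono' ((hcont.aestronglyMeasurable measurableSet_Ioi).norm.pow 2) ?_
  filter_upwards [ae_restrict_mem measurableSet_Ioi] with t ht
  have ht0 : (0 : ℝ) < t := ht
  have key : ∀ {C r : ℝ}, 0 ≤ C → ‖thetaTail w f t⁻¹‖ ≤ C * t⁻¹ ^ r →
      ‖(t : ℂ) ^ (w - 1) * thetaTail w f t⁻¹‖ ≤ C * t ^ (w.re - 1 - r) := by
    intro C r hC h
    rw [norm_mul, norm_cpow_of_pos ht0, Complex.sub_re, Complex.one_re]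
    calc _ ≤ t ^ (w.re - 1) * (C * t⁻¹ ^ r) := by gcongr
      _ = _ := by
        rw [Real.inv_rpow ht0.le, Real.rpow_sub ht0 (w.re - 1)]
        ring
  have habs := neg_abs_le w.re
  have habs' := le_abs_self w.re
  rw [Real.norm_of_nonneg (by positivity)]
  split_ifs with h
  · have h3 := key hC₁ (h₁ t⁻¹ (inv_pos.2 ht0))
    rw [Real.rpow_zero, mul_one]
    refine pow_le_pow_left₀ (norm_nonneg _) (h3.trans ?_) 2
    refine mul_le_of_le_one_right hC₁ (Real.rpow_le_one ht0.le h.le (by linarith))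
  · have h3 := key hC₂ (h₂ t⁻¹ (inv_pos.2 ht0))
    have h4 : t ^ (w.re - 1 - (|w.re| + 1)) ≤ t ^ (-2 : ℝ) :=
      Real.rpow_le_rpow_of_exponent_le (not_lt.1 h) (by linarith)
    calc _ ≤ (C₂ * t ^ (-2 : ℝ)) ^ 2 :=
          pow_le_pow_left₀ (norm_nonneg _) (h3.trans (by gcongr)) 2
      _ = _ := by
        rw [mul_pow, ← Real.rpow_natCast (t ^ (-2 : ℝ)), ← Real.rpow_mul ht0.le]
        norm_num

/-- A nonzero multiple of the Hardy transform is the sum of t^{w-1} times the tail of θ_f at t⁻¹,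
square integrable thanks to the zero at w, and of an operator κ whose kernel passes Schur's test. -/
theorem memLp_hardy_of_re_pos {a : ℝ} (ha : 0 < a) {w : ℂ} (hre : 0 < w.re) {f : HalfLineL2}
    (hf : f ∈ sonineSpace a) (hw : mellin (theta f) w = 0) :
    MemLp (hardy w f) 2 (volume.restrict (Ioi (0 : ℝ))) := by
  obtain ⟨C, hC, hC1, hC2⟩ := exists_norm_incGamma_le hre
  set H₀ := incGamma w 0 with hH₀
  have hH : H₀ ≠ 0 := by
    rw [hH₀, incGamma_zero hre]
    exact div_ne_zero (Complex.Gammaℝ_ne_zero_of_re_pos hre) two_ne_zero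
  -- The sharp cutoff H₀ · 1_{v<t} minus its smoothed version: subtracting H₀ cancels the
  -- singularity r^{-Re w} of the profile at r = 0.
  set κ : ℝ → ℝ → ℂ := fun t v => (t : ℂ) ^ (w - 1) * (v : ℂ) ^ (-w) *
    ((if v < t then H₀ else 0) - incGamma w (t⁻¹ * v)) with hκ
  have hκm : Measurable (Function.uncurry κ) := by
    simp only [hκ, Function.uncurry_def]
    refine Measurable.mul (by fun_prop) (Measurable.sub ?_ ?_)
    · exact Measurable.ite (measurableSet_lt measurable_snd measurable_fst) measurable_const
        measurable_const
    · exact (measurable_incGamma w).comp (by fun_prop)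
  have h1 : MemLp (fun t => ∫ v in Ioi (0 : ℝ), κ t v * f v) 2
      (volume.restrict (Ioi (0 : ℝ))) := by
    refine memLp_integral_kernel_of_real hκm
      (k := fun r => if r < 1 then C else C * (r ^ (-w.re) * r⁻¹)) ?_ ?_ ?_ f
    · exact Measurable.ite measurableSet_Iio measurable_const (by fun_prop)
    · intro t ht v hv
      have e : t⁻¹ * v < 1 ↔ v < t := by rw [inv_mul_lt_iff₀ ht, mul_one]
      have hr : 0 < t⁻¹ * v := by positivity
      have e2 : ‖(t : ℂ) ^ (w - 1) * (v : ℂ) ^ (-w)‖ = t⁻¹ * (t⁻¹ * v) ^ (-w.re) := by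
        rw [norm_mul, norm_cpow_of_pos ht, norm_cpow_of_pos hv, Complex.sub_re, Complex.one_re,
          Complex.neg_re, Real.mul_rpow (by positivity) hv.le, Real.inv_rpow ht.le,
          Real.rpow_neg ht.le, inv_inv, Real.rpow_sub_one ht.ne']
        ring
      simp only [hκ]
      rw [norm_mul, e2, mul_assoc]
      simp only [e]
      gcongr
      split_ifs with h
      · calc _ ≤ (t⁻¹ * v) ^ (-w.re) * (C * (t⁻¹ * v) ^ w.re) := by
              gcongr
              exact hC1 _ hr
          _ = C := by
            rw [Real.rpow_neg hr.le]
            have := Real.rpow_pos_of_pos hr w.re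
            field_simp
      · have h' : 1 ≤ t⁻¹ * v := not_lt.1 fun hlt => h (e.1 hlt)
        rw [zero_sub, norm_neg]
        calc _ ≤ (t⁻¹ * v) ^ (-w.re) * (C * (t⁻¹ * v)⁻¹) := by
              gcongr
              exact hC2 _ h'
          _ = _ := by ring
    · refine integrableOn_Ioi_of_pieces (p := -1 / 2) (q := -w.re + -1 + -1 / 2) (C₁ := C)
        (C₂ := C) (by norm_num) (by linarith) (fun r h0 h1 => ?_) (fun r h1 => ?_)
      · simp only [if_pos h1]
      · have hr : 0 < r := by linarith
        simp only [if_neg (not_lt.2 h1)]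
        rw [Real.rpow_add hr, Real.rpow_add hr, Real.rpow_neg_one]
        ring
  have h2 := memLp_cpow_mul_thetaTail ha hf hw
  refine ((h1.add h2).const_mul H₀⁻¹).ae_eq ?_
  filter_upwards [ae_restrict_mem measurableSet_Ioi] with t ht
  have ht0 : (0 : ℝ) < t := ht
  obtain ⟨hi, htail⟩ := thetaTail_eq ha w hf.1 (inv_pos.2 ht0)
  have e : ∀ v, κ t v * f v = H₀ * (hardyKernel w t v * f v)
      - (t : ℂ) ^ (w - 1) * (f v * ((v : ℂ) ^ (-w) * incGamma w (v * t⁻¹))) := by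
    intro v
    simp only [hκ, hardyKernel]
    rw [mul_comm v t⁻¹]
    split_ifs <;> ring
  simp only [Pi.add_apply]
  rw [htail]
  simp_rw [e]
  rw [integral_sub ((integrable_hardyKernel_mul ha w hf.1 t).const_mul _) (hi.const_mul _),
    integral_const_mul, integral_const_mul, ← hardy]
  field_simp
  ring

/-- The half-planes Re w < 1/2 and Re w > 0 cover the plane. -/
theorem memLp_hardy {a : ℝ} (ha : 0 < a) {w : ℂ} {f : HalfLineL2} (hf : f ∈ sonineSpace a)
    (hw : mellin (theta f) w = 0) : MemLp (hardy w f) 2 (volume.restrict (Ioi (0 : ℝ))) := by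
  rcases lt_or_ge w.re (1 / 2) with h | h
  · exact memLp_hardy_of_re_lt h f
  · exact memLp_hardy_of_re_pos ha (by linarith) hf hw

/-! ### Division by linear factors -/

/-- The functional equation, by u ↦ u⁻¹. It carries a zero w of M(f) to the zero 1 - w for the
cosine transform of f. -/
theorem mellin_theta_cosineTransform (f : HalfLineL2) (s : ℂ) :
    mellin (theta (cosineTransform f)) (1 - s) = mellin (theta f) s := by
  have e : mellin (theta (cosineTransform f)) (1 - s)
      = mellin (fun u : ℝ => (u : ℂ) ^ (-1 : ℂ) • theta f u⁻¹) (1 - s) := by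
    refine setIntegral_congr_fun measurableSet_Ioi fun u hu => ?_
    simp only
    rw [theta_cosineTransform f hu, Complex.cpow_neg_one, smul_eq_mul, smul_eq_mul, smul_eq_mul]
  rw [e, mellin_cpow_smul, mellin_comp_inv]
  congr 1
  ring

/-- The zero at w turns the tail beyond u⁻¹ into minus the integral over (0,u⁻¹], and x ↦ x⁻¹ maps
that to a tail beyond u. -/
theorem thetaTail_inv {a : ℝ} (ha : 0 < a) {w : ℂ} {f : HalfLineL2} (hf : f ∈ sonineSpace a)
    (hw : mellin (theta f) w = 0) {u : ℝ} (hu : 0 < u) :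
    thetaTail w f u⁻¹ = -thetaTail (1 - w) (cosineTransform f) u := by
  have h := thetaTail_add ha w hf (inv_pos.2 hu)
  rw [hw] at h
  rw [eq_neg_of_add_eq_zero_right h, neg_inj]
  have h2 := integral_comp_rpow_Ioi
    ((Iic u⁻¹).indicator fun x : ℝ => (x : ℂ) ^ (w - 1) * theta f x) (p := -1) (by norm_num)
  rw [setIntegral_indicator measurableSet_Iic, Ioi_inter_Iic] at h2
  rw [← h2, thetaTail, ← inter_eq_left.2 (Ioi_subset_Ioi hu.le : Ioi u ⊆ Ioi 0), inter_comm,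
    ← setIntegral_indicator measurableSet_Ioi]
  -- Inversion matches a closed half-line with an open one, up to the endpoint.
  have hne : ∀ᵐ x : ℝ ∂(volume.restrict (Ioi (0 : ℝ))), x ≠ u :=
    ae_restrict_of_ae (Measure.ae_ne volume u)
  refine integral_congr_ae ?_
  filter_upwards [ae_restrict_mem measurableSet_Ioi, hne] with x hx hxu
  have hx0 : (0 : ℝ) < x := hx
  have hx' : (x : ℂ) ≠ 0 := by exact_mod_cast hx0.ne'
  rw [Real.rpow_neg_one]
  by_cases h : u < x
  · have h1 : x⁻¹ ∈ Iic u⁻¹ := by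
      rw [mem_Iic]
      gcongr
    rw [indicator_of_mem h1, indicator_of_mem (show x ∈ Ioi u from h), theta_cosineTransform f hx0,
      Complex.real_smul, Complex.ofReal_inv, Complex.inv_cpow _ _ (by
        rw [Complex.arg_ofReal_of_nonneg hx0.le]; exact Real.pi_pos.ne),
      show (-1 - 1 : ℝ) = -2 by norm_num, show |(-1 : ℝ)| = 1 by norm_num, one_mul,
      Real.rpow_neg hx0.le, Real.rpow_two, show 1 - w - 1 = -w by ring, Complex.cpow_sub _ _ hx',
      Complex.cpow_neg, Complex.cpow_one]
    have : (x : ℂ) ^ w ≠ 0 := by simp [Complex.cpow_eq_zero_iff, hx']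
    push_cast
    field_simp
  · have hxu' : x < u := lt_of_le_of_ne (not_lt.1 h) hxu
    have h1 : x⁻¹ ∉ Iic u⁻¹ := by
      rw [mem_Iic, not_le]
      gcongr
    rw [indicator_of_notMem h1, indicator_of_notMem (show x ∉ Ioi u from h), smul_zero]

/-- The Hardy transform as an element of `L²(0,∞)`. -/
def hardyLp {w : ℂ} {f : HalfLineL2} (h : MemLp (hardy w f) 2 (volume.restrict (Ioi (0 : ℝ)))) :
    HalfLineL2 := h.toLp _

theorem theta_hardyLp {a : ℝ} (ha : 0 < a) {w : ℂ} {f : HalfLineL2} (hf : f ∈ vanishingBelow a)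
    (h : MemLp (hardy w f) 2 (volume.restrict (Ioi (0 : ℝ)))) {u : ℝ} (hu : 0 < u) :
    theta (hardyLp h) u = (u : ℂ) ^ (-w) * thetaTail w f u := by
  rw [← integral_hardy_mul_gaussian ha w hf hu]
  refine integral_congr_ae ?_
  filter_upwards [h.coeFn_toLp] with t ht
  rw [hardyLp, ht]

theorem hardyLp_mem_vanishingBelow {a : ℝ} {w : ℂ} {f : HalfLineL2} (hf : f ∈ vanishingBelow a)
    (h : MemLp (hardy w f) 2 (volume.restrict (Ioi (0 : ℝ)))) :
    hardyLp h ∈ vanishingBelow a := by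
  rw [mem_vanishingBelow]
  filter_upwards [h.coeFn_toLp] with t ht hta
  rw [hardyLp, ht, hardy]
  refine integral_eq_zero_of_ae ?_
  filter_upwards [mem_vanishingBelow.1 hf] with v hv
  simp only [Pi.zero_apply, hardyKernel]
  split_ifs with hvt
  · rw [hv (hvt.trans hta), mul_zero]
  · rw [zero_mul]

/-- This symmetry is what keeps the quotient in K_a: a Hardy transform inherits vanishing on (0,a),
and here the cosine transform of one is again a Hardy transform up to sign. -/
theorem cosineTransform_hardyLp {a : ℝ} (ha : 0 < a) {w : ℂ} {f : HalfLineL2}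
    (hf : f ∈ sonineSpace a) (hw : mellin (theta f) w = 0)
    (h : MemLp (hardy w f) 2 (volume.restrict (Ioi (0 : ℝ))))
    (h' : MemLp (hardy (1 - w) (cosineTransform f)) 2 (volume.restrict (Ioi (0 : ℝ)))) :
    cosineTransform (hardyLp h) = -hardyLp h' := by
  refine eq_of_theta fun u hu => ?_
  have hu' : (u : ℂ) ≠ 0 := by exact_mod_cast hu.ne'
  have hf' := mem_sonineSpace.1 hf
  rw [theta_cosineTransform _ hu, theta_neg _ hu, theta_hardyLp ha hf'.1 h (inv_pos.2 hu),
    theta_hardyLp ha hf'.2 h' hu, thetaTail_inv ha hf hw hu, Complex.ofReal_inv,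
    Complex.inv_cpow _ _ (by rw [Complex.arg_ofReal_of_nonneg hu.le]; exact Real.pi_pos.ne),
    neg_sub, Complex.cpow_sub _ _ hu', Complex.cpow_neg, inv_inv, Complex.cpow_one]
  field_simp

theorem tendsto_cpow_mul_thetaTail {a : ℝ} (ha : 0 < a) {w : ℂ} {f : HalfLineL2}
    (hf : f ∈ sonineSpace a) (hw : mellin (theta f) w = 0) (z : ℂ) :
    Tendsto (fun u : ℝ => (u : ℂ) ^ z * thetaTail w f u) (𝓝[>] 0) (𝓝 0) ∧
    Tendsto (fun u : ℝ => (u : ℂ) ^ z * thetaTail w f u) atTop (𝓝 0) := by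
  have hle : ∀ {r : ℝ}, r ≠ 0 → ∃ C, ∀ u : ℝ, 0 < u →
      ‖(u : ℂ) ^ z * thetaTail w f u‖ ≤ C * u ^ (z.re + r) := by
    intro r hr
    obtain ⟨C, -, h⟩ := exists_norm_thetaTail_le ha hf hw hr
    refine ⟨C, fun u hu => ?_⟩
    rw [norm_mul, norm_cpow_of_pos hu, Real.rpow_add hu]
    calc _ ≤ u ^ z.re * (C * u ^ r) := by gcongr; exact h u hu
      _ = _ := by ring
  have habs := neg_abs_le z.re
  have habs' := le_abs_self z.re
  have hq : 0 < |z.re| + 1 := by positivity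
  constructor
  · obtain ⟨C, h⟩ := hle hq.ne'
    refine squeeze_zero_norm' (a := fun u => C * u ^ (z.re + (|z.re| + 1))) ?_ ?_
    · filter_upwards [self_mem_nhdsWithin] with u hu using h u hu
    · have hp : 0 < z.re + (|z.re| + 1) := by linarith
      have := ((Real.continuousAt_rpow_const 0 _ (Or.inr hp.le)).tendsto.const_mul C).mono_left
        (nhdsWithin_le_nhds (s := Ioi (0 : ℝ)))
      simpa [Real.zero_rpow hp.ne'] using this
  · obtain ⟨C, h⟩ := hle (neg_ne_zero.2 hq.ne')
    refine squeeze_zero_norm' (a := fun u => C * u ^ (z.re + -(|z.re| + 1))) ?_ ?_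
    · filter_upwards [eventually_gt_atTop 0] with u hu using h u hu
    · have hp : 0 < -(z.re + -(|z.re| + 1)) := by linarith
      have := (tendsto_rpow_neg_atTop hp).const_mul C
      simpa using this

/-- Integration by parts of u^{s-w} against the derivative of the tail; the boundary terms vanish by
`tendsto_cpow_mul_thetaTail`. -/
theorem mellin_theta_hardyLp {a : ℝ} (ha : 0 < a) {w : ℂ} {f : HalfLineL2}
    (hf : f ∈ sonineSpace a) (hw : mellin (theta f) w = 0)
    (h : MemLp (hardy w f) 2 (volume.restrict (Ioi (0 : ℝ)))) (hg : hardyLp h ∈ sonineSpace a)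
    (s : ℂ) : mellin (theta f) s = (s - w) * mellin (theta (hardyLp h)) s := by
  have hf' := mem_sonineSpace.1 hf
  have e : ∀ u : ℝ, 0 < u → (s - w) * (u : ℂ) ^ (s - w - 1) * thetaTail w f u
      + (u : ℂ) ^ (s - w) * (-((u : ℂ) ^ (w - 1) * theta f u))
      = (s - w) * ((u : ℂ) ^ (s - 1) * theta (hardyLp h) u) - (u : ℂ) ^ (s - 1) * theta f u := by
    intro u hu
    have hu' : (u : ℂ) ≠ 0 := by exact_mod_cast hu.ne'
    rw [theta_hardyLp ha hf'.1 h hu, show s - w - 1 = (s - 1) + -w by ring,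
      Complex.cpow_add _ _ hu', show (u : ℂ) ^ (s - 1) = (u : ℂ) ^ (s - w) * (u : ℂ) ^ (w - 1) by
        rw [← Complex.cpow_add _ _ hu']; congr 1; ring]
    ring
  have hi1 : IntegrableOn (fun u : ℝ => (u : ℂ) ^ (s - 1) * theta (hardyLp h) u) (Ioi 0) :=
    integrableOn_cpow_mul_theta ha s hg
  have hi2 : IntegrableOn (fun u : ℝ => (u : ℂ) ^ (s - 1) * theta f u) (Ioi 0) :=
    integrableOn_cpow_mul_theta ha s hf
  obtain ⟨t0, t1⟩ := tendsto_cpow_mul_thetaTail ha hf hw (s - w)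
  have key := integral_Ioi_deriv_mul_eq_sub (a := 0)
    (u := fun u : ℝ => (u : ℂ) ^ (s - w)) (u' := fun u : ℝ => (s - w) * (u : ℂ) ^ (s - w - 1))
    (v := thetaTail w f) (v' := fun u => -((u : ℂ) ^ (w - 1) * theta f u)) ?_
    (fun u hu => hasDerivAt_thetaTail ha w hf hu) ?_ t0 t1
  · rw [setIntegral_congr_fun measurableSet_Ioi fun u hu => e u hu,
      integral_sub (hi1.const_mul _) hi2, integral_const_mul, sub_zero, sub_eq_zero] at key
    exact key.symm
  · intro u hu
    have h1 := ((hasDerivAt_id (u : ℂ)).cpow_const (c := s - w)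
      (Complex.ofReal_mem_slitPlane.2 hu)).comp_ofReal
    simpa using h1
  · refine IntegrableOn.congr_fun ((hi1.const_mul (s - w)).sub hi2) (fun u hu => ?_)
      measurableSet_Ioi
    exact (e u hu).symm

/-- The completed Mellin transforms of a Sonine space are stable under division by the linear
factor of a zero. -/
theorem exists_completedMellin_eq_sub_mul {a : ℝ} (ha : 0 < a) {f : HalfLineL2}
    (hf : f ∈ sonineSpace a) {w : ℂ} (hw : completedMellin f w = 0) :
    ∃ g ∈ sonineSpace a, ∀ s, completedMellin f s = (s - w) * completedMellin g s := by
  rw [completedMellin_eq ha hf] at hw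
  have hw1 : mellin (theta f) w = 0 := by simpa using hw
  have hFf := cosineTransform_mem hf
  have hw2 : mellin (theta (cosineTransform f)) (1 - w) = 0 := by
    rw [mellin_theta_cosineTransform, hw1]
  have h := memLp_hardy ha hf hw1
  have h' := memLp_hardy ha hFf hw2
  have m1 : hardyLp h ∈ vanishingBelow a := hardyLp_mem_vanishingBelow (mem_sonineSpace.1 hf).1 h
  have m2 : cosineTransform (hardyLp h) ∈ vanishingBelow a := by
    rw [cosineTransform_hardyLp ha hf hw1 h h']
    exact neg_mem (hardyLp_mem_vanishingBelow (mem_sonineSpace.1 hf).2 h')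
  have hg : hardyLp h ∈ sonineSpace a := mem_sonineSpace.2 ⟨m1, m2⟩
  refine ⟨hardyLp h, hg, fun s => ?_⟩
  rw [completedMellin_eq ha hf, completedMellin_eq ha hg]
  simp only
  rw [mellin_theta_hardyLp ha hf hw1 h hg s]
  ring

/-! ### Orders of vanishing -/

theorem analyticAt_completedMellin {a : ℝ} (ha : 0 < a) {f : HalfLineL2} (hf : f ∈ sonineSpace a)
    (z : ℂ) : AnalyticAt ℂ (completedMellin f) z :=
  (differentiable_completedMellin ha hf).analyticAt z

/-- The vanishing conditions attached to `m`, in terms of orders of vanishing. -/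
theorem natCast_le_order_iff {a : ℝ} (ha : 0 < a) {f : HalfLineL2} (hf : f ∈ sonineSpace a)
    (z : ℂ) (n : ℕ) : (n : ℕ∞) ≤ analyticOrderAt (completedMellin f) z ↔
      ∀ i < n, iteratedDeriv i (completedMellin f) z = 0 :=
  natCast_le_analyticOrderAt_iff_iteratedDeriv_eq_zero (analyticAt_completedMellin ha hf z)

theorem order_completedMellin_ne_top {a : ℝ} (ha : 0 < a) {f : HalfLineL2}
    (hf : f ∈ sonineSpace a) (hf0 : f ≠ 0) (z : ℂ) :
    analyticOrderAt (completedMellin f) z ≠ ⊤ := by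
  rw [Ne, AnalyticOnNhd.analyticOrderAt_eq_top_iff_eq_zero z fun x => analyticAt_completedMellin ha hf x]
  exact fun h => hf0 (eq_zero_of_completedMellin ha hf h)

theorem analyticOrderAt_pow_mul {F G : ℂ → ℂ} {w : ℂ} {j : ℕ} (hG : ∀ z, AnalyticAt ℂ G z)
    (h : ∀ s, F s = (s - w) ^ j * G s) (z : ℂ) :
    analyticOrderAt F z = (if z = w then (j : ℕ∞) else 0) + analyticOrderAt G z := by
  have e : F = (fun s => (s - w) ^ j) * G := funext h
  rw [e, analyticOrderAt_mul (by fun_prop) (hG z)]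
  congr 1
  have e2 : (fun s : ℂ => (s - w) ^ j) = (fun s => s - w) ^ j := rfl
  rw [e2, analyticOrderAt_pow (by fun_prop)]
  split_ifs with hz
  · subst hz
    have : analyticOrderAt (fun s : ℂ => s - z) z = 1 := by
      exact (analyticAt_id (𝕜 := ℂ) (z := z)).analyticOrderAt_sub_eq_one_of_deriv_ne_zero
        (by simp)
    rw [this]
    simp
  · have : analyticOrderAt (fun s : ℂ => s - w) z = 0 := by
      rw [AnalyticAt.analyticOrderAt_eq_zero (by fun_prop)]
      exact sub_ne_zero.2 hz
    rw [this]
    simp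

/-- Dividing out a zero of order `N` at `w` down to a zero of order `N - j`. -/
theorem exists_completedMellin_eq_pow_mul {a : ℝ} (ha : 0 < a) {f : HalfLineL2}
    (hf : f ∈ sonineSpace a) {w : ℂ} {N : ℕ}
    (hN : (N : ℕ∞) ≤ analyticOrderAt (completedMellin f) w) {j : ℕ} (hj : j ≤ N) :
    ∃ g ∈ sonineSpace a, ∀ s, completedMellin f s = (s - w) ^ j * completedMellin g s := by
  induction j with
  | zero => exact ⟨f, hf, fun s => by simp⟩
  | succ j ih =>
    obtain ⟨g, hg, hfg⟩ := ih (by omega)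
    have horder := analyticOrderAt_pow_mul (analyticAt_completedMellin ha hg) hfg w
    have hzero : completedMellin g w = 0 := by
      by_contra hne
      rw [if_pos rfl, ((analyticAt_completedMellin ha hg w).analyticOrderAt_eq_zero).2 hne,
        add_zero] at horder
      rw [horder] at hN
      have : N ≤ j := by exact_mod_cast hN
      omega
    obtain ⟨g', hg', hgg'⟩ := exists_completedMellin_eq_sub_mul ha hg hzero
    exact ⟨g', hg', fun s => by rw [hfg, hgg']; ring⟩

/-- From a function with all the prescribed zeros, functions with a prescribed order of vanishing
at one of them. -/
theorem exists_order_eq {a : ℝ} (ha : 0 < a) {m : ℂ → ℕ} {f : HalfLineL2}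
    (hf : f ∈ sonineSpace a) (hf0 : f ≠ 0)
    (hm : ∀ z, ∀ i < m z, iteratedDeriv i (completedMellin f) z = 0) (w : ℂ) {k : ℕ}
    (hk : k < m w) :
    ∃ g : sonineSpace a, (∀ z ≠ w, ∀ i < m z, evalForm ha z i g = 0) ∧
      (∀ i < k, evalForm ha w i g = 0) ∧ evalForm ha w k g ≠ 0 := by
  obtain ⟨N, hN⟩ := ENat.ne_top_iff_exists.1 (order_completedMellin_ne_top ha hf hf0 w)
  have hmN : m w ≤ N := by
    have := (natCast_le_order_iff ha hf w (m w)).2 (hm w)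
    rw [← hN] at this
    exact_mod_cast this
  -- The true order N may exceed m(w); removing N - k factors leaves order exactly k.
  obtain ⟨g, hg, hfg⟩ := exists_completedMellin_eq_pow_mul ha hf hN.le (j := N - k) (by omega)
  have horder := analyticOrderAt_pow_mul (analyticAt_completedMellin ha hg) hfg
  have hgw : analyticOrderAt (completedMellin g) w = k := by
    have h := horder w
    rw [if_pos rfl, ← hN] at h
    have hne : analyticOrderAt (completedMellin g) w ≠ ⊤ := by
      intro htop
      rw [htop, add_top] at h
      exact ENat.natCast_ne_top N h
    obtain ⟨n, hn⟩ := ENat.ne_top_iff_exists.1 hne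
    rw [← hn] at h ⊢
    have h' : N = (N - k) + n := by exact_mod_cast h
    have : n = k := by omega
    rw [this]
  refine ⟨⟨g, hg⟩, fun z hz i hi => ?_, fun i hi => ?_, fun h => ?_⟩
  · have h := (natCast_le_order_iff ha hf z (m z)).2 (hm z)
    rw [horder z, if_neg hz, zero_add] at h
    exact (natCast_le_order_iff ha hg z (m z)).1 h i hi
  · exact (natCast_le_order_iff ha hg w k).1 hgw.ge i hi
  -- If the k-th derivative vanished as well, the order would be at least k + 1.
  · have h2 : ((k + 1 : ℕ) : ℕ∞) ≤ analyticOrderAt (completedMellin g) w := by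
      refine (natCast_le_order_iff ha hg w (k + 1)).2 fun i hi => ?_
      rcases Nat.lt_succ_iff_lt_or_eq.1 hi with h' | h'
      · exact (natCast_le_order_iff ha hg w k).1 hgw.ge i h'
      · rw [h']
        exact h
    rw [hgw] at h2
    have : k + 1 ≤ k := by exact_mod_cast h2
    omega

/-! ### Minimality and completeness -/

/-- A function of exact order k at w is already right except for its derivatives of orders between k
and m(w). These are cleared one at a time, in increasing order, by functions of exact order p, which
do not disturb the earlier ones. -/
theorem isMinimalSystem_of_not_isCompleteSystem {a : ℝ} (ha : 0 < a) {m : ℂ → ℕ}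
    (h : ¬ IsCompleteSystem (evaluatorSystem m a)) : IsMinimalSystem (evaluatorSystem m a) := by
  rw [isCompleteSystem_iff ha] at h
  push Not at h
  obtain ⟨f, hf, hm, hf0⟩ := h
  rw [isMinimalSystem_iff ha]
  intro w k hk
  have key : ∀ p, k < p → p ≤ m w → ∃ g : sonineSpace a,
      (∀ z ≠ w, ∀ i < m z, evalForm ha z i g = 0) ∧
      (∀ i < p, i ≠ k → evalForm ha w i g = 0) ∧ evalForm ha w k g ≠ 0 := by
    intro p hp
    induction p, hp using Nat.le_induction with
    | base =>
      intro _
      obtain ⟨g, h1, h2, h3⟩ := exists_order_eq ha hf hf0 hm w hk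
      exact ⟨g, h1, fun i hi hik => h2 i (by omega), h3⟩
    | succ p hp ih =>
      intro hpm
      obtain ⟨g, h1, h2, h3⟩ := ih (by omega)
      obtain ⟨g', h1', h2', h3'⟩ := exists_order_eq ha hf hf0 hm w (k := p) (by omega)
      -- The coefficient kills the p-th derivative; all lower ones are untouched since g' has order
      -- p.
      refine ⟨g - (evalForm ha w p g / evalForm ha w p g') • g', fun z hz i hi => ?_,
        fun i hi hik => ?_, ?_⟩
      · rw [map_sub, map_smul, h1 z hz i hi, h1' z hz i hi, smul_zero, sub_zero]
      · rw [map_sub, map_smul, smul_eq_mul]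
        rcases Nat.lt_succ_iff_lt_or_eq.1 hi with h' | h'
        · rw [h2 i h' hik, h2' i h', mul_zero, sub_zero]
        · rw [h', div_mul_cancel₀ _ h3', sub_self]
      · rw [map_sub, map_smul, h2' k hp, smul_zero, sub_zero]
        exact h3
  obtain ⟨g, h1, h2, h3⟩ := key (m w) hk le_rfl
  refine ⟨g, g.2, h3, fun z j hj hne => ?_⟩
  by_cases hz : z = w
  · subst hz
    exact h2 j hj fun hjk => hne (by rw [hjk])
  · exact h1 z hz j hj

/-- The strict inequality leaves room for a nontrivial dilation, hence for multiplying M(f) by a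
nonconstant exponential minus its value at w. -/
theorem not_isCompleteSystem_of_isMinimalSystem {a b : ℝ} (ha : 0 < a) (hab : a < b) {m : ℂ → ℕ}
    (hne : (Function.support m).Nonempty) (h : IsMinimalSystem (evaluatorSystem m b)) :
    ¬ IsCompleteSystem (evaluatorSystem m a) := by
  have hb := ha.trans hab
  obtain ⟨w, hw⟩ := hne
  have hw' : 0 < m w := Nat.pos_of_ne_zero hw
  -- With the last index m(w) - 1, the other conditions at w amount to a zero of order at least m(w)
  -- - 1, so one simple zero is all that is missing.
  obtain ⟨f, hf, hfw, hfz⟩ := (isMinimalSystem_iff hb m).1 h w (m w - 1) (by omega)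
  have hfa : f ∈ sonineSpace a := sonineSpace_anti hab.le hf
  have hr : 0 < b / a := div_pos hb ha
  have hr1 : 1 < b / a := (one_lt_div ha).2 hab
  have hrc : ((b / a : ℝ) : ℂ) ≠ 0 := by exact_mod_cast hr.ne'
  set φ : ℂ → ℂ := fun s => ((b / a : ℝ) : ℂ) ^ (s - 1) with hφ
  have hφd : ∀ s, HasDerivAt φ (φ s * Complex.log ((b / a : ℝ) : ℂ)) s := fun s => by
    have h := ((hasDerivAt_id s).sub_const 1).const_cpow (c := ((b / a : ℝ) : ℂ)) (Or.inl hrc)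
    rw [mul_one] at h
    exact h
  have hφdiff : Differentiable ℂ φ := fun s => (hφd s).differentiableAt
  have hφa : ∀ s, AnalyticAt ℂ φ s := fun s => hφdiff.analyticAt s
  -- The zero is simple because log(b/a) ≠ 0.
  have hφ1 : analyticOrderAt (fun s => φ s - φ w) w = 1 := by
    refine (hφa w).analyticOrderAt_sub_eq_one_of_deriv_ne_zero ?_
    rw [(hφd w).deriv]
    refine mul_ne_zero (fun h0 => hrc ((Complex.cpow_eq_zero_iff _ _).1 h0).1) ?_
    rw [← Complex.ofReal_log hr.le]
    exact_mod_cast (Real.log_pos hr1).ne'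
  set g : HalfLineL2 := dilation hr f + (-φ w) • f with hg
  have hdm : dilation hr f ∈ sonineSpace a := dilation_mem_sonineSpace ha hab hf
  have hsm : (-φ w) • f ∈ sonineSpace a := Submodule.smul_mem _ _ hfa
  have hgm : g ∈ sonineSpace a := add_mem hdm hsm
  have hMg : completedMellin g = (fun s => φ s - φ w) * completedMellin f := by
    rw [hg, completedMellin_add ha hdm hsm, completedMellin_smul ha _ hfa]
    ext s
    simp only [Pi.add_apply, Pi.smul_apply, Pi.mul_apply, smul_eq_mul]
    rw [completedMellin_dilation ha hab hf]
    ring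
  have horder : ∀ z, analyticOrderAt (completedMellin g) z
      = analyticOrderAt (fun s => φ s - φ w) z + analyticOrderAt (completedMellin f) z := fun z => by
    have hψ : AnalyticAt ℂ (fun s => φ s - φ w) z := (hφa z).sub analyticAt_const
    rw [hMg, analyticOrderAt_mul hψ (analyticAt_completedMellin ha hfa z)]
  have hge : ∀ z, (m z : ℕ∞) ≤ analyticOrderAt (completedMellin g) z := by
    intro z
    rw [horder z]
    by_cases hz : z = w
    · subst hz
      have : ((m z - 1 : ℕ) : ℕ∞) ≤ analyticOrderAt (completedMellin f) z :=
        (natCast_le_order_iff ha hfa z _).2 fun i hi => hfz z i (by omega) fun he => by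
          have := (Prod.mk.inj he).2
          omega
      rw [hφ1]
      calc (m z : ℕ∞) = ((1 + (m z - 1) : ℕ) : ℕ∞) := by congr 1; omega
        _ = 1 + ((m z - 1 : ℕ) : ℕ∞) := by push_cast; rfl
        _ ≤ _ := by gcongr
    · refine le_add_left ((natCast_le_order_iff ha hfa z _).2 fun i hi => hfz z i hi fun he => ?_)
      exact hz (Prod.mk.inj he).1
  rw [isCompleteSystem_iff ha]
  intro H
  have hg0 : g = 0 := H g hgm fun z => (natCast_le_order_iff ha hgm z (m z)).1 (hge z)
  have hMg0 : completedMellin g = 0 := by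
    have := completedMellin_smul ha 0 (zero_mem (sonineSpace a))
    rw [hg0]
    simpa using this
  -- If g were 0 the order at w would be infinite, whereas it is one more than the finite order of
  -- M(f).
  have htop : analyticOrderAt (completedMellin g) w = ⊤ := by
    rw [hMg0, analyticOrderAt_eq_top]
    exact .of_forall fun _ => rfl
  rw [horder w, hφ1] at htop
  have hf0 : f ≠ 0 := by
    rintro rfl
    refine hfw ?_
    have h0 := completedMellin_smul ha 0 (zero_mem (sonineSpace a))
    rw [zero_smul, zero_smul] at h0
    rw [h0]
    simp
  have hft := order_completedMellin_ne_top ha hfa hf0 w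
  obtain ⟨n, hn⟩ := ENat.ne_top_iff_exists.1 hft
  rw [← hn] at htop
  exact ENat.natCast_ne_top (1 + n) (by push_cast; exact htop)

theorem IsMinimalSystem.anti {a b : ℝ} (ha : 0 < a) (hab : a ≤ b) {m : ℂ → ℕ}
    (h : IsMinimalSystem (evaluatorSystem m b)) : IsMinimalSystem (evaluatorSystem m a) := by
  rw [isMinimalSystem_iff (ha.trans_le hab)] at h
  rw [isMinimalSystem_iff ha]
  intro w k hk
  obtain ⟨f, hf, h1, h2⟩ := h w k hk
  exact ⟨f, sonineSpace_anti hab hf, h1, h2⟩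

theorem IsCompleteSystem.mono {a b : ℝ} (ha : 0 < a) (hab : a ≤ b) {m : ℂ → ℕ}
    (h : IsCompleteSystem (evaluatorSystem m a)) : IsCompleteSystem (evaluatorSystem m b) := by
  rw [isCompleteSystem_iff ha] at h
  rw [isCompleteSystem_iff (ha.trans_le hab)]
  exact fun f hf => h f (sonineSpace_anti hab hf)

end Sonine

end

/-- A countable nonempty multiset of complex numbers with finite multiplicities is given by its
multiplicity function `m`. The two thresholds separate minimality from non-minimality and
non-completeness from completeness, and they coincide. -/
theorem mainTheorem5 (m : ℂ → ℕ) (hcount : (Function.support m).Countable)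
    (hne : (Function.support m).Nonempty) :
    (∀ a : ℝ, 0 < a →
      (ENNReal.ofReal a < Sonine.minimalityThreshold m →
        Sonine.IsMinimalSystem (Sonine.evaluatorSystem m a)) ∧
      (Sonine.minimalityThreshold m < ENNReal.ofReal a →
        ¬ Sonine.IsMinimalSystem (Sonine.evaluatorSystem m a))) ∧
    (∀ a : ℝ, 0 < a →
      (Sonine.completenessThreshold m < ENNReal.ofReal a →
        Sonine.IsCompleteSystem (Sonine.evaluatorSystem m a)) ∧
      (ENNReal.ofReal a < Sonine.completenessThreshold m →
        ¬ Sonine.IsCompleteSystem (Sonine.evaluatorSystem m a))) ∧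
    Sonine.minimalityThreshold m = Sonine.completenessThreshold m := by
  have hmin : ∀ a : ℝ, 0 < a → Sonine.minimalityThreshold m < ENNReal.ofReal a →
      ¬ Sonine.IsMinimalSystem (Sonine.evaluatorSystem m a) := fun a ha h hm =>
    (le_sSup ⟨a, ha, rfl, hm⟩ : ENNReal.ofReal a ≤ Sonine.minimalityThreshold m).not_gt h
  have hcom : ∀ a : ℝ, 0 < a → ENNReal.ofReal a < Sonine.completenessThreshold m →
      ¬ Sonine.IsCompleteSystem (Sonine.evaluatorSystem m a) := fun a ha h hc =>
    (sInf_le ⟨a, ha, rfl, hc⟩ : Sonine.completenessThreshold m ≤ ENNReal.ofReal a).not_gt h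
  refine ⟨fun a ha => ⟨fun h => ?_, hmin a ha⟩, fun a ha => ⟨fun h => ?_, hcom a ha⟩,
    le_antisymm ?_ ?_⟩
  · obtain ⟨_, ⟨b, hb, rfl, hm⟩, hab⟩ := lt_sSup_iff.1 h
    exact Sonine.IsMinimalSystem.anti ha ((ENNReal.ofReal_lt_ofReal_iff hb).1 hab).le hm
  · obtain ⟨_, ⟨b, hb, rfl, hc⟩, hba⟩ := sInf_lt_iff.1 h
    exact Sonine.IsCompleteSystem.mono hb ((ENNReal.ofReal_lt_ofReal_iff ha).1 hba).le hc
  · refine sSup_le ?_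
    rintro _ ⟨b, hb, rfl, hm⟩
    refine le_sInf ?_
    rintro _ ⟨a, ha, rfl, hc⟩
    refine ENNReal.ofReal_le_ofReal (not_lt.1 fun hab => ?_)
    exact Sonine.not_isCompleteSystem_of_isMinimalSystem ha hab hne hm hc
  · by_contra hlt
    -- Strictly between the thresholds x is finite and positive, and the system there would be
    -- neither complete nor minimal.
    obtain ⟨x, hx1, hx2⟩ := exists_between (not_le.1 hlt)
    have hxt : x ≠ ∞ := hx2.ne_top
    have hx : ENNReal.ofReal x.toReal = x := ENNReal.ofReal_toReal hxt
    have hx0 : 0 < x.toReal := ENNReal.toReal_pos (ne_bot_of_gt hx1) hxt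
    rw [← hx] at hx1 hx2
    exact hmin _ hx0 hx1 (Sonine.isMinimalSystem_of_not_isCompleteSystem hx0 (hcom _ hx0 hx2))
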